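/- **Algebras.** An *action lattice* is an algebra $(A,\wedge,\vee,\cdot,\backslash,/,{}^*,0,1)$ such that $(A,\wedge,\vee)$ is a lattice with least element $0$, $(A,\cdot,1)$ is a monoid, $x\cdot y\le z\iff y\le x\backslash z\iff x\le z/y$, and $1\vee xx^*\le x^*$, $xy\le y\Rightarrow x^*y\le y$, $yx\le y\Rightarrow yx^*\le y$, for all $x,y,z \in A$. It is *$*$-continuous* if $a^*=\bigvee_{n\in\mathbb N}a^n$ for all $a\in A$. **Sequents and rules.** Formulas are the terms in this language over a countably infinite set of propositional variables; a sequent $\Gamma\Rightarrow\beta$ consists of a finite sequence $\Gamma$ of formulas and a formula $\beta$. An *analytic rule* is a schematic rule with finitely many (possibly no) premises $\Gamma,\Upsilon_i,\Delta\Rightarrow\beta$ $(i<n)$ and conclusion $\Gamma,\Upsilon,\Delta\Rightarrow\beta$, where $\Gamma,\Delta$ are sequence metavariables, $\beta$ is a formula metavariable, $\Upsilon$ is a finite sequence of sequence metavariables, all of $\Gamma,\Delta$ and the members of $\Upsilon$ are distinct, and each $\Upsilon_i$ is a finite sequence of metavariables occurring in $\Upsilon$ (repetitions allowed). Its *analytic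 quasiequation* is $$q_a(R):\quad t(\Upsilon_0)\le y\ \&\ \cdots\ \&\ t(\Upsilon_{n-1})\le y\implies t(\Upsilon)\le y,$$ where $t$ replaces distinct metavariables by distinct variables and forms their product (the empty product is $1$), and $y$ is the variable of $\beta$. For a set $\mathcal R$ of analytic rules put $Q_a(\mathcal R)=\{q_a(R)\mid R\in\mathcal R\}$. Both systems below have the identity axiom $a\Rightarrow a$ for propositional variables $a$, the rules in $\mathcal R$, and the following *principal rules* (premises before the bar, conclusion after it; $i\in\{0,1\}$): - $0$L: $\ \mid\ \Gamma,0,\Delta\Rightarrow\beta$; $1$L: $\Gamma,\Delta\Rightarrow\beta\ \mid\ \Gamma,1,\Delta\Rightarrow\beta$; $1$R: $\ \mid\ \Rightarrow1$; - $\wedge$L$_i$: $\Gamma,\alpha_i,\Delta\Rightarrow\beta\ \mid\ \Gamma,\alpha_0\wedge\alpha_1,\Delta\Rightarrow\beta$; $\wedge$R: $\Gamma\Rightarrow\alpha_0;\ \Gamma\Rightarrow\alpha_1\ \mid\ \Gamma\Rightarrow\alpha_0\wedge\alpha_1$; - $\vee$L: $\Gamma,\alpha_0,\Delta\Rightarrow\beta;\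 \Gamma,\alpha_1,\Delta\Rightarrow\beta\ \mid\ \Gamma,\alpha_0\vee\alpha_1,\Delta\Rightarrow\beta$; $\vee$R$_i$: $\Gamma\Rightarrow\alpha_i\ \mid\ \Gamma\Rightarrow\alpha_0\vee\alpha_1$; - $\cdot$L: $\Gamma,\alpha_0,\alpha_1,\Delta\Rightarrow\beta\ \mid\ \Gamma,\alpha_0\cdot\alpha_1,\Delta\Rightarrow\beta$; $\cdot$R: $\Gamma\Rightarrow\alpha_0;\ \Delta\Rightarrow\alpha_1\ \mid\ \Gamma,\Delta\Rightarrow\alpha_0\cdot\alpha_1$; - $\backslash$L: $\Delta\Rightarrow\alpha_0;\ \Gamma,\alpha_1,\Sigma\Rightarrow\beta\ \mid\ \Gamma,\Delta,\alpha_0\backslash\alpha_1,\Sigma\Rightarrow\beta$; $\backslash$R: $\alpha_0,\Gamma\Rightarrow\alpha_1\ \mid\ \Gamma\Rightarrow\alpha_0\backslash\alpha_1$; - $/$L: $\Delta\Rightarrow\alpha_0;\ \Gamma,\alpha_1,\Sigma\Rightarrow\beta\ \mid\ \Gamma,\alpha_1/\alpha_0,\Delta,\Sigma\Rightarrow\beta$;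 $/$R: $\Gamma,\alpha_0\Rightarrow\alpha_1\ \mid\ \Gamma\Rightarrow\alpha_1/\alpha_0$; - $*$R$_0$: $\ \mid\ \Rightarrow\alpha^*$; $*$R$_1$: $\Gamma\Rightarrow\alpha;\ \Delta\Rightarrow\alpha^*\ \mid\ \Gamma,\Delta\Rightarrow\alpha^*$. In each of these, and in the two left rules for $*$ below, the *principal* occurrence is the occurrence in the conclusion of the formula introduced by the rule ($0$, $1$, $\alpha_0\wedge\alpha_1$, $\alpha^*$, etc.). The *auxiliary* occurrences are the displayed occurrences in the premises of $\alpha_i$, $\alpha$, $\alpha^*$, i.e. all those outside the contexts $\Gamma,\Delta,\Sigma$ and $\beta$. Analytic rules have no principal or auxiliary occurrences. A *preproof* is a possibly non-wellfounded tree, each node of which carries a rule instance (given by an instantiation of the metavariables of the rule, or an identity axiom) whose premises are, in order, exactly the sequents concluded at its successors; in particular every leaf carries an instance of a rule without premises. A formula occurrence in a premise of a rule instance is an *immediate ancestor* of one in the conclusion if the first is auxiliary and the second principal, or both come from the same formula metavariable, or both come from the same position in the instantiation of the same sequence metavariable. A *thread* along an infinite branch assigns to each index $i$ in a non-empty interval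 $I\subseteq\mathbb N$ a formula occurrence in the $i$-th sequent of the branch such that the occurrence at $i+1$ is an immediate ancestor of the one at $i$ whenever $i,i+1\in I$. It is *progressing* if on some final segment of $I$ it stays on the left-hand side, always denotes one and the same formula $\alpha^*$, and is principal infinitely often. - ${}^*\mathsf L_\omega+\mathcal R$ has in addition the rule with premises $\Gamma,\alpha^{(n)},\Delta\Rightarrow\beta$ for all $n\in\mathbb N$ and conclusion $\Gamma,\alpha^*,\Delta\Rightarrow\beta$, where $\alpha^{(n)}$ is the sequence of $n$ copies of $\alpha$; its proofs are the preproofs without infinite branches. - ${}^*\mathsf L+\mathcal R$ has instead the rule with premises $\Gamma,\Delta\Rightarrow\beta$ and $\Gamma,\alpha,\alpha^*,\Delta\Rightarrow\beta$ and conclusion $\Gamma,\alpha^*,\Delta\Rightarrow\beta$; its proofs are the preproofs in which every infinite branch has a progressing thread. **Theorem.** Let $\mathcal R$ be a set of analytic rules. Then ${}^*\mathsf L_\omega+\mathcal R$ and ${}^*\mathsf L+\mathcal R$ are both sound and complete with respect to the class of $*$-continuous action lattices satisfying $Q_a(\mathcal R)$. That is, for each of the two systems and for every sequent $\alpha_1,\dots,\alpha_n\Rightarrow\beta$,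 the sequent has a proof in the system if and only if the inequation $\alpha_1\cdots\alpha_n\le\beta$ (with left-hand side $1$ if $n=0$) is valid in every $*$-continuous action lattice that satisfies all quasiequations in $Q_a(\mathcal R)$. -/

import Mathlib

/-!
Action lattices, the formula algebra, sequents, schematic rules with their principal and auxiliary
occurrences, analytic structural rules and their quasiequations, non-wellfounded preproofs, threads,
and the two proof systems (the wellfounded one and the non-wellfounded one).
-/

universe u

namespace ActionLogic

open scoped Computability

/-! ### Action lattices -/

/-- Residuated lattices: `lres x z` is `x \ z` and `rres z y` is `z / y`. -/
class ResiduatedLattice (A : Type u) extends Lattice A, Monoid A where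
  lres : A → A → A
  rres : A → A → A
  mul_le_iff_le_lres : ∀ x y z : A, x * y ≤ z ↔ y ≤ lres x z
  mul_le_iff_le_rres : ∀ x y z : A, x * y ≤ z ↔ x ≤ rres z y

/-- Action lattices; the constant `0` of the language is the least element `⊥`. -/
class ActionLattice (A : Type u) extends ResiduatedLattice A, OrderBot A, KStar A where
  one_sup_mul_star_le : ∀ x : A, 1 ⊔ x * x∗ ≤ x∗
  star_mul_le : ∀ x y : A, x * y ≤ y → x∗ * y ≤ y
  mul_star_le : ∀ x y : A, y * x ≤ y → y * x∗ ≤ y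

/-- `*`-continuity: `a∗` is the supremum of the powers of `a`. -/
def IsStarContinuous (A : Type u) [ActionLattice A] : Prop :=
  ∀ a : A, IsLUB (Set.range fun n : ℕ => a ^ n) (a∗)

/-! ### Formulas, sequents and quasiequations -/

/-- The absolutely free algebra over `ℕ` in the language of action lattices. It serves both as the
algebra of formulas (over the propositional variables) and as the algebra of metaformulas
(over the formula metavariables). -/
inductive Formula : Type
  | var (a : ℕ)
  | zero
  | one
  | inf (φ ψ : Formula)
  | sup (φ ψ : Formula)
  | mul (φ ψ : Formula)
  /-- `φ \ ψ` -/
  | lres (φ ψ : Formula)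
  /-- `φ / ψ` -/
  | rres (φ ψ : Formula)
  | star (φ : Formula)

namespace Formula

/-- The homomorphic extension of a substitution of formulas for variables. -/
def subst (σ : ℕ → Formula) : Formula → Formula
  | var a => σ a
  | zero => zero
  | one => one
  | inf φ ψ => inf (φ.subst σ) (ψ.subst σ)
  | sup φ ψ => sup (φ.subst σ) (ψ.subst σ)
  | mul φ ψ => mul (φ.subst σ) (ψ.subst σ)
  | lres φ ψ => lres (φ.subst σ) (ψ.subst σ)
  | rres φ ψ => rres (φ.subst σ) (ψ.subst σ)
  | star φ => star (φ.subst σ)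

/-- The homomorphic extension of a valuation into an action lattice. -/
def eval {A : Type u} [ActionLattice A] (v : ℕ → A) : Formula → A
  | var a => v a
  | zero => ⊥
  | one => 1
  | inf φ ψ => φ.eval v ⊓ ψ.eval v
  | sup φ ψ => φ.eval v ⊔ ψ.eval v
  | mul φ ψ => φ.eval v * ψ.eval v
  | lres φ ψ => ResiduatedLattice.lres (φ.eval v) (ψ.eval v)
  | rres φ ψ => ResiduatedLattice.rres (φ.eval v) (ψ.eval v)
  | star φ => (φ.eval v)∗

/-- The product of a finite sequence of formulas; the empty product is `1`. -/
def prod : List Formula → Formula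
  | [] => one
  | [φ] => φ
  | φ :: ψ :: l => mul φ (prod (ψ :: l))

end Formula

/-- An inequation `lhs ≤ rhs` between formulas. -/
structure Inequation where
  lhs : Formula
  rhs : Formula

/-- The inequation holds under the valuation `v`. -/
def Inequation.HoldsAt {A : Type u} [ActionLattice A] (e : Inequation) (v : ℕ → A) : Prop :=
  e.lhs.eval v ≤ e.rhs.eval v

/-- A quasiequation `e₁ & ... & eₙ ⟹ e`. -/
structure Quasiequation where
  prems : List Inequation
  concl : Inequation

/-- The action lattice `A` satisfies the quasiequation `q`. -/
def Quasiequation.Holds (q : Quasiequation) (A : Type u) [ActionLattice A] : Prop :=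
  ∀ v : ℕ → A, (∀ e ∈ q.prems, e.HoldsAt v) → q.concl.HoldsAt v

/-- A sequent `ant ⇒ succ`. -/
structure Sequent where
  ant : List Formula
  succ : Formula

/-- The inequation `α₁ ⋯ αₙ ≤ β` of the sequent `α₁, …, αₙ ⇒ β`. -/
def Sequent.toInequation (S : Sequent) : Inequation :=
  ⟨Formula.prod S.ant, S.succ⟩

/-- The inequation of the sequent `S` is valid in every `*`-continuous action lattice (in the
universe `u`) that satisfies all the quasiequations in `Q`. -/
def ValidIn (Q : Set Quasiequation) (S : Sequent) : Prop :=
  ∀ (A : Type u) [ActionLattice A], IsStarContinuous A → (∀ q ∈ Q, q.Holds A) →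
    ∀ v : ℕ → A, S.toInequation.HoldsAt v

/-! ### Schematic rules -/

/-- A metaformula occurring in a schematic rule, possibly boxed. In the conclusion of a rule the
boxed formula is the principal one, in the premises the boxed formulas are the auxiliary ones. -/
structure MFormula where
  fml : Formula
  boxed : Bool

/-- Entries of the left-hand side of a schematic sequent: sequence metavariables and
metaformulas. -/
inductive MItem : Type
  | seq (X : ℕ)
  | fml (φ : MFormula)

/-- A schematic sequent. -/
structure MSequent where
  ant : List MItem
  succ : MFormula

/-- A schematic rule. The premises are indexed by an initial segment of `ℕ`, so that rules with
infinitely many premises are covered. -/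
structure Schema where
  prem : ℕ → Option MSequent
  concl : MSequent

/-- A schematic rule with finitely many premises. -/
def Schema.ofList (prems : List MSequent) (concl : MSequent) : Schema :=
  ⟨fun i => prems[i]?, concl⟩

/-- A metavariable instantiation. -/
structure Instantiation where
  seq : ℕ → List Formula
  fml : ℕ → Formula

/-- Where a formula occurrence of an instantiated sequent comes from: position `i` of the
instantiation of the sequence metavariable `X`, the formula metavariable `p`, a boxed metaformula,
or none of these. -/
inductive Origin : Type
  | seqVar (X i : ℕ)
  | fmlVar (p : ℕ)
  | box
  | other

/-- A sequent in which every formula occurrence carries its origin. -/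
structure TracedSequent where
  ant : List (Formula × Origin)
  succ : Formula × Origin

/-- Forget the origins. -/
def TracedSequent.toSequent (S : TracedSequent) : Sequent :=
  ⟨S.ant.map Prod.fst, S.succ.1⟩

def MFormula.origin (φ : MFormula) : Origin :=
  if φ.boxed then .box else
    match φ.fml with
    | .var p => .fmlVar p
    | _ => .other

def MFormula.inst (σ : Instantiation) (φ : MFormula) : Formula × Origin :=
  (φ.fml.subst σ.fml, φ.origin)

def MItem.inst (σ : Instantiation) : MItem → List (Formula × Origin)
  | .seq X => (σ.seq X).mapIdx fun i φ => (φ, .seqVar X i)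
  | .fml φ => [φ.inst σ]

def MSequent.inst (σ : Instantiation) (S : MSequent) : TracedSequent :=
  ⟨S.ant.flatMap (MItem.inst σ), S.succ.inst σ⟩

/-- Formula occurrences of a sequent: `none` denotes the formula on the right (position `-1`)
and `some i` the `i`-th formula on the left. -/
abbrev Occ := Option ℕ

/-- The formula at an occurrence, with its origin; undefined if there is no such occurrence. -/
def TracedSequent.formulaAt (S : TracedSequent) : Occ → Option (Formula × Origin)
  | none => some S.succ
  | some i => S.ant[i]?

/-- The occurrence `o'` of the premise `P` is an immediate ancestor of the occurrence `o` of the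
conclusion `C`: both come from the same position of the same sequence metavariable, or both from the
same formula metavariable, or `o` is principal and `o'` is auxiliary. -/
def ImmediateAncestor (C P : TracedSequent) (o o' : Occ) : Prop :=
  ∃ (φ φ' : Formula) (t : Origin),
    t ≠ .other ∧ C.formulaAt o = some (φ, t) ∧ P.formulaAt o' = some (φ', t)

/-! ### The principal rules -/

namespace Schema

/-- A boxed metaformula on the left. -/
def bx (φ : Formula) : MItem := .fml ⟨φ, true⟩

/-- A sequent whose right-hand side is not boxed. -/
def sq (l : List MItem) (φ : Formula) : MSequent := ⟨l, ⟨φ, false⟩⟩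

/-- A sequent whose right-hand side is boxed. -/
def sqb (l : List MItem) (φ : Formula) : MSequent := ⟨l, ⟨φ, true⟩⟩

/-- Sequence metavariables. -/
def G : MItem := .seq 0
def D : MItem := .seq 1
def E : MItem := .seq 2

/-- Formula metavariables: `a`, `a₀`, `a₁` for displayed formulas and `b` for the right context. -/
def a : Formula := .var 0
def a₀ : Formula := .var 1
def a₁ : Formula := .var 2
def b : Formula := .var 3

def zeroL : Schema := ofList [] (sq [G, bx .zero, D] b)

def oneL : Schema := ofList [sq [G, D] b] (sq [G, bx .one, D] b)

def oneR : Schema := ofList [] (sqb [] .one)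

def infL₀ : Schema := ofList [sq [G, bx a₀, D] b] (sq [G, bx (.inf a₀ a₁), D] b)

def infL₁ : Schema := ofList [sq [G, bx a₁, D] b] (sq [G, bx (.inf a₀ a₁), D] b)

def infR : Schema := ofList [sqb [G] a₀, sqb [G] a₁] (sqb [G] (.inf a₀ a₁))

def supL : Schema :=
  ofList [sq [G, bx a₀, D] b, sq [G, bx a₁, D] b] (sq [G, bx (.sup a₀ a₁), D] b)

def supR₀ : Schema := ofList [sqb [G] a₀] (sqb [G] (.sup a₀ a₁))

def supR₁ : Schema := ofList [sqb [G] a₁] (sqb [G] (.sup a₀ a₁))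

def mulL : Schema := ofList [sq [G, bx a₀, bx a₁, D] b] (sq [G, bx (.mul a₀ a₁), D] b)

def mulR : Schema := ofList [sqb [G] a₀, sqb [D] a₁] (sqb [G, D] (.mul a₀ a₁))

def lresL : Schema :=
  ofList [sqb [D] a₀, sq [G, bx a₁, E] b] (sq [G, D, bx (.lres a₀ a₁), E] b)

def rresL : Schema :=
  ofList [sqb [D] a₀, sq [G, bx a₁, E] b] (sq [G, bx (.rres a₁ a₀), D, E] b)

def lresR : Schema := ofList [sqb [bx a₀, G] a₁] (sqb [G] (.lres a₀ a₁))

def rresR : Schema := ofList [sqb [G, bx a₀] a₁] (sqb [G] (.rres a₁ a₀))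

def starR₀ : Schema := ofList [] (sqb [] (.star a))

def starR₁ : Schema := ofList [sqb [G] a, sqb [D] (.star a)] (sqb [G, D] (.star a))

/-- The `ω`-rule for the star: one premise `Γ, α, …, α, Δ ⇒ β` (`n` copies of `α`) for every
natural number `n`. -/
def starLω : Schema :=
  ⟨fun n => some (sq (G :: (List.replicate n (bx a) ++ [D])) b), sq [G, bx (.star a), D] b⟩

/-- The finitary unfolding rule for the star. -/
def starL : Schema :=
  ofList [sq [G, D] b, sq [G, bx a, bx (.star a), D] b] (sq [G, bx (.star a), D] b)

/-- The principal rules other than the two left rules for the star. -/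
def common : Set Schema :=
  {zeroL, oneL, oneR, infL₀, infL₁, infR, supL, supR₀, supR₁, mulL, mulR, lresL, rresL, lresR,
    rresR, starR₀, starR₁}

end Schema

/-! ### Analytic structural rules -/

/-- An analytic structural rule: from the premises `Γ, Υᵢ, Δ ⇒ β`, for `Υᵢ` in the list `prems`,
infer `Γ, Υ, Δ ⇒ β`. Here `Γ`, `Δ` and the members of `Υ` are distinct sequence metavariables, `β`
is a formula metavariable, and each `Υᵢ` is a sequence of metavariables from `Υ`, possibly with
repetitions. -/
structure AnalyticRule where
  Γ : ℕ
  Δ : ℕ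
  β : ℕ
  Υ : List ℕ
  prems : List (List ℕ)
  nodup : (Γ :: Δ :: Υ).Nodup
  prems_sub : ∀ Υ' ∈ prems, ∀ X ∈ Υ', X ∈ Υ

namespace AnalyticRule

/-- The schematic sequent `Γ, l, Δ ⇒ β`. -/
def sequent (r : AnalyticRule) (l : List ℕ) : MSequent :=
  ⟨MItem.seq r.Γ :: (l.map MItem.seq ++ [MItem.seq r.Δ]), ⟨.var r.β, false⟩⟩

/-- The schematic rule; nothing is boxed. -/
def toSchema (r : AnalyticRule) : Schema :=
  Schema.ofList (r.prems.map r.sequent) (r.sequent r.Υ)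

/-- The variable that corresponds to a metavariable, under a fixed bijection between the
metavariables (sequence metavariables on the left, formula metavariables on the right) and the
variables. -/
def toVar : ℕ ⊕ ℕ ≃ ℕ := Equiv.natSumNatEquivNat

/-- The term of a sequence of sequence metavariables: the product of the variables. -/
def term (l : List ℕ) : Formula :=
  Formula.prod (l.map fun X => .var (toVar (.inl X)))

/-- The analytic quasiequation of the rule: `t(Υ₀) ≤ y & ... & t(Υₙ₋₁) ≤ y ⟹ t(Υ) ≤ y`. -/
def quasiequation (r : AnalyticRule) : Quasiequation where
  prems := r.prems.map fun l => ⟨term l, .var (toVar (.inr r.β))⟩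
  concl := ⟨term r.Υ, .var (toVar (.inr r.β))⟩

end AnalyticRule

/-! ### Preproofs and proof systems -/

/-- Rules: the identity axiom (which is not schematic), and schematic rules. -/
inductive Rule : Type
  | ident
  | schema (r : Schema)

/-- An instance of a rule, given by the instantiation that produces it. The instances of the
identity axiom are `x ⇒ x` for propositional variables `x`. -/
inductive RuleInstance : Type
  | ident (x : ℕ)
  | schema (r : Schema) (σ : Instantiation)

namespace RuleInstance

def rule : RuleInstance → Rule
  | ident _ => .ident
  | schema r _ => .schema r

def concl : RuleInstance → TracedSequent
  | ident x => ⟨[(.var x, .other)], (.var x, .other)⟩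
  | schema r σ => r.concl.inst σ

/-- The `i`-th premise, if there is one. -/
def prem : RuleInstance → ℕ → Option TracedSequent
  | ident _, _ => none
  | schema r σ, i => (r.prem i).map (MSequent.inst σ)

end RuleInstance

/-- A preproof: a possibly non-wellfounded tree of rule instances. A node `w` has a successor
`w ++ [i]` exactly if the rule instance at `w` has an `i`-th premise, and the conclusion of the rule
instance at `w ++ [i]` is that premise. -/
structure Preproof (rules : Set Rule) where
  node : List ℕ → Option RuleInstance
  root_mem : node [] ≠ none
  prefix_closed : ∀ w i, node (w ++ [i]) ≠ none → node w ≠ none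
  rule_mem : ∀ w s, node w = some s → s.rule ∈ rules
  premises : ∀ w s, node w = some s → ∀ i,
    (node (w ++ [i])).map (fun s' => s'.concl.toSequent) = (s.prem i).map TracedSequent.toSequent

namespace Preproof

variable {rules : Set Rule}

/-- The sequent at the root of the preproof is `S`. -/
def Concludes (π : Preproof rules) (S : Sequent) : Prop :=
  ∃ s, π.node [] = some s ∧ s.concl.toSequent = S

/-- An infinite branch. -/
def IsBranch (π : Preproof rules) (p : ℕ → List ℕ) : Prop :=
  p 0 = [] ∧ (∀ i, ∃ n, p (i + 1) = p i ++ [n]) ∧ ∀ i, π.node (p i) ≠ none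

/-- The formula at the occurrence `o` of the sequent at the node `w`, with its origin in the rule
instance at `w`. -/
def formulaAt (π : Preproof rules) (w : List ℕ) (o : Occ) : Option (Formula × Origin) :=
  (π.node w).bind fun s => s.concl.formulaAt o

/-- The occurrence `o'` at the `n`-th successor of the node `w` is an immediate ancestor of the
occurrence `o` at `w`. -/
def Ancestor (π : Preproof rules) (w : List ℕ) (n : ℕ) (o o' : Occ) : Prop :=
  ∃ s P, π.node w = some s ∧ s.prem n = some P ∧ ImmediateAncestor s.concl P o o'

/-- `o` is the principal occurrence at the node `w`. -/
def Principal (π : Preproof rules) (w : List ℕ) (o : Occ) : Prop :=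
  ∃ φ, π.formulaAt w o = some (φ, .box)

/-- `t`, restricted to the interval `I`, is a thread along the branch `p`. -/
def IsThread (π : Preproof rules) (p : ℕ → List ℕ) (I : Set ℕ) (t : ℕ → Occ) : Prop :=
  I.Nonempty ∧ I.OrdConnected ∧ (∀ i ∈ I, π.formulaAt (p i) (t i) ≠ none) ∧
    ∀ i, i ∈ I → i + 1 ∈ I → ∃ n, p (i + 1) = p i ++ [n] ∧ π.Ancestor (p i) n (t i) (t (i + 1))

/-- A thread that stays on the left and always denotes the same `*`-formula. -/
def IsStarThread (π : Preproof rules) (p : ℕ → List ℕ) (I : Set ℕ) (t : ℕ → Occ) : Prop :=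
  π.IsThread p I t ∧
    ∃ α : Formula, ∀ i ∈ I, t i ≠ none ∧ ∃ o, π.formulaAt (p i) (t i) = some (.star α, o)

/-- The thread `t` on `I` is progressing: its restriction to some final segment `J` of `I` is a
`*`-thread that is principal infinitely often. -/
def IsProgressing (π : Preproof rules) (p : ℕ → List ℕ) (I : Set ℕ) (t : ℕ → Occ) : Prop :=
  π.IsThread p I t ∧
    ∃ J ⊆ I, (∀ i ∈ J, ∀ j ∈ I, i ≤ j → j ∈ J) ∧ π.IsStarThread p J t ∧
      {i | i ∈ J ∧ π.Principal (p i) (t i)}.Infinite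

end Preproof

/-- A proof system: a set of rules, and a condition on the branches of preproofs. -/
structure ProofSystem where
  rules : Set Rule
  branchCondition : Preproof rules → (ℕ → List ℕ) → Prop

/-- `S` has a proof: a preproof all of whose branches satisfy the branch condition. -/
def ProofSystem.Provable (L : ProofSystem) (S : Sequent) : Prop :=
  ∃ π : Preproof L.rules, π.Concludes S ∧ ∀ p, π.IsBranch p → L.branchCondition π p

/-- The rules of the wellfounded and of the non-wellfounded system, for a given left rule for the
star. -/
def rulesWith (starLeft : Schema) (R : Set AnalyticRule) : Set Rule :=
  insert Rule.ident
    (Rule.schema '' (Schema.common ∪ {starLeft} ∪ AnalyticRule.toSchema '' R))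

/-- The wellfounded system with the `ω`-rule and the rules in `R`: no infinite branches. -/
def omegaSystem (R : Set AnalyticRule) : ProofSystem where
  rules := rulesWith Schema.starLω R
  branchCondition := fun _ _ => False

/-- The non-wellfounded system with the unfolding rule and the rules in `R`: every infinite branch
has a progressing thread. -/
def nonWellfoundedSystem (R : Set AnalyticRule) : ProofSystem where
  rules := rulesWith Schema.starL R
  branchCondition := fun π p => ∃ I t, π.IsProgressing p I t

end ActionLogic

/-!
Soundness. If the conclusion of a rule fails in a `*`-continuous algebra, then so does a premise,
and a false sequent at the root thus yields a branch of false sequents. In the non-wellfounded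
system we moreover replace each star `α∗` on the left by a power `α ^ n` with which the sequent
still fails: the exponent never increases along a thread, and it decreases whenever the star is
principal, so that the branch has no progressing thread.

Completeness. The `ω`-rule is admissible in the non-wellfounded system: unfold the star forever.
Each infinite branch of the resulting comb either runs into one of the given proofs or is the spine,
where the star is principal at each step. Hence the provable sequents of either system are closed
under the rules of the system with the `ω`-rule. For a set of sequents with this closure property,
the sets of sequences of formulas that are closed with respect to derivability in contexts form a
quantale that satisfies the quasiequations of the analytic rules. There the value of each formula
contains the formula, and only sequences that derive it.
-/

namespace ActionLogic

open scoped Computability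
open ResiduatedLattice (mul_le_iff_le_lres mul_le_iff_le_rres)

/-! ### Residuated lattices and quantales -/

section ResiduatedLattice

variable {A : Type u} [ResiduatedLattice A]

instance : MulLeftMono A :=
  ⟨fun x _ _ h => (mul_le_iff_le_lres x _ _).2 (h.trans ((mul_le_iff_le_lres x _ _).1 le_rfl))⟩

instance : MulRightMono A :=
  ⟨fun x _ _ h => (mul_le_iff_le_rres _ x _).2 (h.trans ((mul_le_iff_le_rres _ x _).1 le_rfl))⟩

theorem mul_lres_le (x y : A) : x * ResiduatedLattice.lres x y ≤ y :=
  (mul_le_iff_le_lres _ _ _).2 le_rfl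

theorem rres_mul_le (x y : A) : ResiduatedLattice.rres y x * x ≤ y :=
  (mul_le_iff_le_rres _ _ _).2 le_rfl

theorem mul_mul_le_iff_le_rres_lres {x a y z : A} :
    x * (a * y) ≤ z ↔ a ≤ ResiduatedLattice.rres (ResiduatedLattice.lres x z) y := by
  rw [mul_le_iff_le_lres, mul_le_iff_le_rres]

theorem mul_mul_le_of_isLUB {s : Set A} {a x y z : A} (ha : IsLUB s a)
    (h : ∀ b ∈ s, x * (b * y) ≤ z) : x * (a * y) ≤ z :=
  mul_mul_le_iff_le_rres_lres.2 <| ha.2 fun b hb => mul_mul_le_iff_le_rres_lres.1 (h b hb)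

end ResiduatedLattice

section ActionLattice

variable {A : Type u} [ActionLattice A]

theorem one_le_star (x : A) : 1 ≤ x∗ :=
  le_sup_left.trans (ActionLattice.one_sup_mul_star_le x)

theorem mul_star_le_star (x : A) : x * x∗ ≤ x∗ :=
  le_sup_right.trans (ActionLattice.one_sup_mul_star_le x)

theorem Formula.eval_prod (v : ℕ → A) :
    ∀ l : List Formula, (Formula.prod l).eval v = (l.map (Formula.eval v)).prod
  | [] => rfl
  | [φ] => by simp [Formula.prod]
  | φ :: ψ :: l => by
    rw [Formula.prod, Formula.eval, Formula.eval_prod v (ψ :: l), List.map_cons (l := ψ :: l),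
      List.prod_cons]

theorem Sequent.holdsAt_iff (S : Sequent) (v : ℕ → A) :
    S.toInequation.HoldsAt v ↔ (S.ant.map (Formula.eval v)).prod ≤ S.succ.eval v := by
  rw [Inequation.HoldsAt, Sequent.toInequation, Formula.eval_prod]

end ActionLattice

section Pow

variable {M : Type*} [Monoid M] [Preorder M]

theorem pow_mul_le_of_mul_le [MulLeftMono M] {x y : M} (h : x * y ≤ y) (n : ℕ) :
    x ^ n * y ≤ y := by
  induction n with
  | zero => rw [pow_zero, one_mul]
  | succ n ih => rw [pow_succ, mul_assoc]; exact (mul_le_mul_right h _).trans ih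

theorem mul_pow_le_of_mul_le [MulRightMono M] {x y : M} (h : y * x ≤ y) (n : ℕ) :
    y * x ^ n ≤ y := by
  induction n with
  | zero => rw [pow_zero, mul_one]
  | succ n ih => rw [pow_succ', ← mul_assoc]; exact (mul_le_mul_left h _).trans ih

end Pow

section Quantale

variable {A : Type u} [CompleteLattice A] [Monoid A] [IsQuantale A]

/-- A quantale as an action lattice. The star of `x` is the join of the powers of `x`, and the
residuals are those of Mathlib. -/
abbrev actionLatticeOfQuantale (A : Type u) [CompleteLattice A] [Monoid A] [IsQuantale A] :
    ActionLattice A where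
  lres x z := Quantale.rightMulResiduation x z
  rres z y := Quantale.leftMulResiduation y z
  mul_le_iff_le_lres _ _ _ := Quantale.rightMulResiduation_le_iff_mul_le.symm
  mul_le_iff_le_rres _ _ _ := Quantale.leftMulResiduation_le_iff_mul_le.symm
  bot_le _ := bot_le
  kstar x := ⨆ n : ℕ, x ^ n
  one_sup_mul_star_le x := by
    refine sup_le ((pow_zero x).ge.trans (le_iSup (x ^ ·) 0)) ?_
    rw [Quantale.mul_iSup_distrib]
    exact iSup_le fun n => (pow_succ' x n).ge.trans (le_iSup (x ^ ·) (n + 1))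
  star_mul_le x y h := by
    rw [Quantale.iSup_mul_distrib]
    exact iSup_le (pow_mul_le_of_mul_le h)
  mul_star_le x y h := by
    rw [Quantale.mul_iSup_distrib]
    exact iSup_le (mul_pow_le_of_mul_le h)

theorem isStarContinuous_actionLatticeOfQuantale :
    @IsStarContinuous A (actionLatticeOfQuantale A) :=
  fun _ => isLUB_iSup

end Quantale

/-! ### Local soundness -/

section LocalSoundness

variable {A : Type u} [ActionLattice A] {v : ℕ → A} {f : Formula → ℕ → A}

/-- A common setting for the soundness of the two systems: `f φ n`, for `n : ℕ`, are lower
approximations of the value of `φ` with supremum that value. They are exact unless `φ` is a star. -/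
structure IsApproximation (v : ℕ → A) (f : Formula → ℕ → A) : Prop where
  isLUB : ∀ φ, IsLUB (Set.range (f φ)) (φ.eval v)
  eq_eval : ∀ φ n, (∀ α, φ ≠ .star α) → f φ n = φ.eval v

/-- The approximation of stars by powers, for the non-wellfounded system. -/
def Formula.approx (v : ℕ → A) : Formula → ℕ → A
  | .star φ, n => φ.eval v ^ n
  | φ, _ => φ.eval v

theorem Formula.ne_star_self (φ : Formula) : φ ≠ .star φ :=
  ne_of_apply_ne sizeOf (by simp)

theorem isApproximation_eval (v : ℕ → A) : IsApproximation v fun φ _ => φ.eval v where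
  isLUB φ := by simp only [Set.range_const, isLUB_singleton]
  eq_eval _ _ _ := rfl

theorem isApproximation_approx (hA : IsStarContinuous A) (v : ℕ → A) :
    IsApproximation v (Formula.approx v) where
  isLUB φ := by
    cases φ
    case star φ => exact hA (φ.eval v)
    all_goals exact (isApproximation_eval v).isLUB _
  eq_eval φ n h := by
    cases φ
    case star φ => exact absurd rfl (h φ)
    all_goals rfl

theorem IsApproximation.mul_mul_le (hf : IsApproximation v f) {φ : Formula} {x y z : A}
    (h : ∀ n, x * (f φ n * y) ≤ z) : x * (φ.eval v * y) ≤ z :=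
  mul_mul_le_of_isLUB (hf.isLUB φ) (Set.forall_mem_range.2 h)

/-- The value of an item of a schematic sequent: `s` instantiates the formula metavariables, `g`
gives the values of the sequence metavariables, and `μ` chooses the approximants of the values of
the metaformulas. -/
def MItem.value (f : Formula → ℕ → A) (s : ℕ → Formula) (g : ℕ → A) (μ : Formula → ℕ) : MItem → A
  | .seq X => g X
  | .fml φ => f (φ.fml.subst s) (μ φ.fml)

/-- The inequation of a schematic sequent, with approximations on the left-hand side. -/
def MSequent.HoldsWith (v : ℕ → A) (f : Formula → ℕ → A) (s : ℕ → Formula) (g : ℕ → A)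
    (μ : Formula → ℕ) (S : MSequent) : Prop :=
  (S.ant.map (MItem.value f s g μ)).prod ≤ (S.succ.fml.subst s).eval v

/-- If the conclusion of the rule fails, then so does some premise, and a star approximant gets
smaller when passing from a principal to an auxiliary occurrence of the same star. -/
def Schema.LocallySound (v : ℕ → A) (f : Formula → ℕ → A) (r : Schema) : Prop :=
  ∀ s g n, ¬ r.concl.HoldsWith v f s g (fun _ => n) → ∃ i P μ, r.prem i = some P ∧
    ¬ P.HoldsWith v f s g μ ∧ ∀ φ φ' α, MItem.fml φ ∈ r.concl.ant → MItem.fml φ' ∈ P.ant →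
      φ.fml.subst s = .star α → φ'.fml.subst s = .star α → μ φ'.fml < n

namespace Schema

theorem locallySound_ofList {ps : List MSequent} {c : MSequent}
    (hc : ∀ φ, MItem.fml φ ∈ c.ant → ∀ s α, φ.fml.subst s ≠ .star α)
    (h : ∀ s g n, (∀ P ∈ ps, ∀ μ, P.HoldsWith v f s g μ) → c.HoldsWith v f s g (fun _ => n)) :
    (ofList ps c).LocallySound v f := by
  intro s g n hn
  obtain ⟨P, hP, μ, hμ⟩ : ∃ P ∈ ps, ∃ μ, ¬ P.HoldsWith v f s g μ := by
    by_contra! hprems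
    exact hn (h s g n hprems)
  obtain ⟨i, hi⟩ := List.mem_iff_getElem?.1 hP
  exact ⟨i, P, μ, hi, hμ, fun φ φ' α h₁ _ h₂ _ => absurd h₂ (hc φ h₁ s α)⟩

section

attribute [local simp] sq sqb bx G D E a a₀ a₁ b Formula.subst Formula.eval MItem.value
  MSequent.HoldsWith

theorem locallySound_zeroL (hf : IsApproximation v f) : zeroL.LocallySound v f :=
  locallySound_ofList (by simp) fun s g n _ => by
    simpa [hf.eq_eval] using mul_mul_le_of_isLUB isLUB_empty (by simp)

theorem locallySound_oneL (hf : IsApproximation v f) : oneL.LocallySound v f :=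
  locallySound_ofList (by simp) fun s g n h => by simpa [hf.eq_eval] using h

theorem locallySound_oneR : oneR.LocallySound v f :=
  locallySound_ofList (by simp) (by simp)

theorem locallySound_infL₀ (hf : IsApproximation v f) : infL₀.LocallySound v f :=
  locallySound_ofList (by simp) fun s g n h => by
    have h : g 0 * ((s 1).eval v * g 1) ≤ (s 3).eval v :=
      hf.mul_mul_le fun k => by simpa using h _ (.head _) fun _ => k
    suffices g 0 * (((s 1).eval v ⊓ (s 2).eval v) * g 1) ≤ (s 3).eval v by simpa [hf.eq_eval]
    exact le_trans (by gcongr; exact inf_le_left) h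

theorem locallySound_infL₁ (hf : IsApproximation v f) : infL₁.LocallySound v f :=
  locallySound_ofList (by simp) fun s g n h => by
    have h : g 0 * ((s 2).eval v * g 1) ≤ (s 3).eval v :=
      hf.mul_mul_le fun k => by simpa using h _ (.head _) fun _ => k
    suffices g 0 * (((s 1).eval v ⊓ (s 2).eval v) * g 1) ≤ (s 3).eval v by simpa [hf.eq_eval]
    exact le_trans (by gcongr; exact inf_le_right) h

theorem locallySound_infR : infR.LocallySound v f :=
  locallySound_ofList (by simp) fun s g n h => by simpa using h

theorem locallySound_supL (hf : IsApproximation v f) : supL.LocallySound v f :=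
  locallySound_ofList (by simp) fun s g n h => by
    have h₀ : g 0 * ((s 1).eval v * g 1) ≤ (s 3).eval v :=
      hf.mul_mul_le fun k => by simpa using h _ (.head _) fun _ => k
    have h₁ : g 0 * ((s 2).eval v * g 1) ≤ (s 3).eval v :=
      hf.mul_mul_le fun k => by simpa using h _ (.tail _ (.head _)) fun _ => k
    suffices g 0 * (((s 1).eval v ⊔ (s 2).eval v) * g 1) ≤ (s 3).eval v by simpa [hf.eq_eval]
    exact mul_mul_le_of_isLUB isLUB_pair (by simp [h₀, h₁])

theorem locallySound_supR₀ : supR₀.LocallySound v f :=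
  locallySound_ofList (by simp) fun s g n h => le_sup_of_le_left (by simpa using h)

theorem locallySound_supR₁ : supR₁.LocallySound v f :=
  locallySound_ofList (by simp) fun s g n h => le_sup_of_le_right (by simpa using h)

theorem locallySound_mulL (hf : IsApproximation v f) : mulL.LocallySound v f :=
  locallySound_ofList (by simp) fun s g n h => by
    have h (i j : ℕ) : g 0 * (f (s 1) i * (f (s 2) j * g 1)) ≤ (s 3).eval v := by
      simpa using h _ (.head _) fun | .var 1 => i | _ => j
    suffices g 0 * ((s 1).eval v * ((s 2).eval v * g 1)) ≤ (s 3).eval v by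
      simpa [hf.eq_eval, mul_assoc]
    refine hf.mul_mul_le fun i => ?_
    rw [← mul_assoc]
    exact hf.mul_mul_le fun j => by simpa only [mul_assoc] using h i j

theorem locallySound_mulR : mulR.LocallySound v f :=
  locallySound_ofList (by simp) fun s g n h => by
    have h₀ : g 0 ≤ (s 1).eval v := by simpa using h _ (.head _) fun _ => 0
    have h₁ : g 1 ≤ (s 2).eval v := by simpa using h _ (.tail _ (.head _)) fun _ => 0
    simpa using mul_le_mul' h₀ h₁

theorem locallySound_lresL (hf : IsApproximation v f) : lresL.LocallySound v f :=
  locallySound_ofList (by simp) fun s g n h => by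
    have h₀ : g 1 ≤ (s 1).eval v := by simpa using h _ (.head _) fun _ => 0
    have h₁ : g 0 * ((s 2).eval v * g 2) ≤ (s 3).eval v :=
      hf.mul_mul_le fun k => by simpa using h _ (.tail _ (.head _)) fun _ => k
    suffices g 0 * (g 1 * (ResiduatedLattice.lres ((s 1).eval v) ((s 2).eval v) * g 2)) ≤
        (s 3).eval v by simpa [hf.eq_eval]
    rw [← mul_assoc (g 1)]
    exact le_trans (by gcongr; exact (mul_le_mul_left h₀ _).trans (mul_lres_le _ _)) h₁

theorem locallySound_rresL (hf : IsApproximation v f) : rresL.LocallySound v f :=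
  locallySound_ofList (by simp) fun s g n h => by
    have h₀ : g 1 ≤ (s 1).eval v := by simpa using h _ (.head _) fun _ => 0
    have h₁ : g 0 * ((s 2).eval v * g 2) ≤ (s 3).eval v :=
      hf.mul_mul_le fun k => by simpa using h _ (.tail _ (.head _)) fun _ => k
    suffices g 0 * (ResiduatedLattice.rres ((s 2).eval v) ((s 1).eval v) * (g 1 * g 2)) ≤
        (s 3).eval v by simpa [hf.eq_eval]
    rw [← mul_assoc _ (g 1)]
    exact le_trans (by gcongr; exact (mul_le_mul_right h₀ _).trans (rres_mul_le _ _)) h₁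

theorem locallySound_lresR (hf : IsApproximation v f) : lresR.LocallySound v f :=
  locallySound_ofList (by simp) fun s g n h => by
    have h : 1 * ((s 1).eval v * g 0) ≤ (s 2).eval v :=
      hf.mul_mul_le fun k => by simpa using h _ (.head _) fun _ => k
    simpa [← mul_le_iff_le_lres] using h

theorem locallySound_rresR (hf : IsApproximation v f) : rresR.LocallySound v f :=
  locallySound_ofList (by simp) fun s g n h => by
    have h : g 0 * ((s 1).eval v * 1) ≤ (s 2).eval v :=
      hf.mul_mul_le fun k => by simpa using h _ (.head _) fun _ => k
    simpa [← mul_le_iff_le_rres] using h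

theorem locallySound_starR₀ : starR₀.LocallySound v f :=
  locallySound_ofList (by simp) (by simp [one_le_star])

theorem locallySound_starR₁ : starR₁.LocallySound v f :=
  locallySound_ofList (by simp) fun s g n h => by
    have h₀ : g 0 ≤ (s 0).eval v := by simpa using h _ (.head _) fun _ => 0
    have h₁ : g 1 ≤ ((s 0).eval v)∗ := by simpa using h _ (.tail _ (.head _)) fun _ => 0
    simpa using (mul_le_mul' h₀ h₁).trans (mul_star_le_star _)

theorem locallySound_of_mem_common (hf : IsApproximation v f) {r : Schema} (hr : r ∈ common) :
    r.LocallySound v f := by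
  simp only [common, Set.mem_insert_iff, Set.mem_singleton_iff] at hr
  rcases hr with rfl | rfl | rfl | rfl | rfl | rfl | rfl | rfl | rfl | rfl | rfl | rfl | rfl | rfl |
    rfl | rfl | rfl
  exacts [locallySound_zeroL hf, locallySound_oneL hf, locallySound_oneR, locallySound_infL₀ hf,
    locallySound_infL₁ hf, locallySound_infR, locallySound_supL hf, locallySound_supR₀,
    locallySound_supR₁, locallySound_mulL hf, locallySound_mulR, locallySound_lresL hf,
    locallySound_rresL hf, locallySound_lresR hf, locallySound_rresR hf, locallySound_starR₀,
    locallySound_starR₁]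

theorem locallySound_starLω (hA : IsStarContinuous A) (v : ℕ → A) :
    starLω.LocallySound v fun φ _ => φ.eval v := by
  intro s g n hn
  obtain ⟨k, hk⟩ : ∃ k, ¬ g 0 * ((s 0).eval v ^ k * g 1) ≤ (s 3).eval v := by
    by_contra! h
    exact hn (by simpa [starLω] using mul_mul_le_of_isLUB (hA _) (Set.forall_mem_range.2 h))
  refine ⟨k, _, fun _ => 0, rfl, by simpa using hk, fun φ φ' α hφ hφ' h h' => ?_⟩
  obtain rfl : φ = ⟨.star a, true⟩ := by simpa [starLω] using hφ
  obtain ⟨-, rfl⟩ : k ≠ 0 ∧ φ' = ⟨a, true⟩ := by simpa using hφ'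
  obtain rfl : s 0 = α := by simpa using h
  exact absurd h' (Formula.ne_star_self _)

theorem locallySound_starL (hA : IsStarContinuous A) (v : ℕ → A) :
    starL.LocallySound v (Formula.approx v) := by
  intro s g n hn
  have hn : ¬ g 0 * ((s 0).eval v ^ n * g 1) ≤ (s 3).eval v := by
    simpa [starL, ofList, Formula.approx] using hn
  cases n with
  | zero =>
    exact ⟨0, _, fun _ => 0, rfl, by simpa using hn, by simp⟩
  | succ n =>
    rw [pow_succ', mul_assoc] at hn
    obtain ⟨k, hk⟩ : ∃ k, ¬ g 0 * ((s 0).approx v k * ((s 0).eval v ^ n * g 1)) ≤ (s 3).eval v := by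
      by_contra! h
      exact hn ((isApproximation_approx hA v).mul_mul_le h)
    refine ⟨1, _, fun | .var _ => k | _ => n, rfl, by simpa [Formula.approx] using hk,
      fun φ φ' α hφ hφ' h h' => ?_⟩
    obtain rfl : φ = ⟨.star a, true⟩ := by simpa [starL, ofList] using hφ
    obtain rfl | rfl : φ' = ⟨a, true⟩ ∨ φ' = ⟨.star a, true⟩ := by simpa using hφ'
    · obtain rfl : s 0 = α := by simpa using h
      exact absurd h' (Formula.ne_star_self _)
    · exact n.lt_succ_self

theorem locallySound_toSchema {r : AnalyticRule} (hr : r.quasiequation.Holds A) :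
    r.toSchema.LocallySound v f := by
  have holdsWith_iff (s g μ) (l : List ℕ) : (r.sequent l).HoldsWith v f s g μ ↔
      g r.Γ * ((l.map g).prod * g r.Δ) ≤ (s r.β).eval v := by
    simp [AnalyticRule.sequent, Function.comp_def]
  refine locallySound_ofList (by simp [AnalyticRule.sequent]) fun s g n h => ?_
  let y := ResiduatedLattice.rres (ResiduatedLattice.lres (g r.Γ) ((s r.β).eval v)) (g r.Δ)
  have h_quasi : (∀ l ∈ r.prems, (l.map g).prod ≤ y) → (r.Υ.map g).prod ≤ y := by
    simpa [AnalyticRule.quasiequation, AnalyticRule.term, Inequation.HoldsAt, Formula.eval_prod,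
      Function.comp_def] using hr fun i => Sum.elim g (fun _ => y) (AnalyticRule.toVar.symm i)
  rw [holdsWith_iff, mul_mul_le_iff_le_rres_lres]
  refine h_quasi fun l hl => ?_
  rw [← mul_mul_le_iff_le_rres_lres, ← holdsWith_iff s g fun _ => 0]
  exact h _ (List.mem_map_of_mem hl) _

end

end Schema

end LocalSoundness

/-! ### Annotations of failing sequents -/

/-- The sequence metavariable of an item. -/
def MItem.seqVar? : MItem → Option ℕ
  | .seq X => some X
  | .fml _ => none

/-- A rule is linear if the sequence metavariables on the left of its conclusion are distinct, and
there is at most one metaformula, which is boxed. The latter is encoded by listing a metaformula as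
`none` among the sequence metavariables. -/
structure Schema.IsLinear (r : Schema) : Prop where
  nodup : (r.concl.ant.map MItem.seqVar?).Nodup
  boxed : ∀ φ, MItem.fml φ ∈ r.concl.ant → φ.boxed = true

namespace Schema

theorem isLinear_of_mem_common {r : Schema} (hr : r ∈ common) : r.IsLinear := by
  simp only [common, Set.mem_insert_iff, Set.mem_singleton_iff] at hr
  rcases hr with rfl | rfl | rfl | rfl | rfl | rfl | rfl | rfl | rfl | rfl | rfl | rfl | rfl | rfl |
    rfl | rfl | rfl <;> constructor <;>
    simp [zeroL, oneL, oneR, infL₀, infL₁, infR, supL, supR₀, supR₁, mulL, mulR, lresL, rresL,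
      lresR, rresR, starR₀, starR₁, ofList, sq, sqb, bx, G, D, E, MItem.seqVar?]

theorem isLinear_starL : starL.IsLinear := by
  constructor <;> simp [starL, ofList, sq, bx, G, D, MItem.seqVar?]

theorem isLinear_starLω : starLω.IsLinear := by
  constructor <;> simp [starLω, sq, bx, G, D, MItem.seqVar?]

theorem isLinear_toSchema (r : AnalyticRule) : r.toSchema.IsLinear where
  nodup := by
    have h : (r.Γ :: (r.Υ ++ [r.Δ])).Nodup :=
      (((List.perm_append_singleton _ _).cons _).nodup_iff).2 r.nodup
    simpa [AnalyticRule.toSchema, ofList, AnalyticRule.sequent, Function.comp_def, MItem.seqVar?]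
      using h.map (Option.some_injective ℕ)
  boxed := by simp [AnalyticRule.toSchema, ofList, AnalyticRule.sequent]

theorem nodup_snd_inst (σ : Instantiation) (m : MItem) : ((m.inst σ).map Prod.snd).Nodup := by
  cases m with
  | seq X =>
    rw [MItem.inst, List.nodup_iff_injective_get]
    exact fun i j h => by simpa [Fin.ext_iff] using h
  | fml φ => simp [MItem.inst]

theorem IsLinear.nodup_origin {r : Schema} (hr : r.IsLinear) (σ : Instantiation) :
    ((r.concl.inst σ).ant.map Prod.snd).Nodup := by
  rw [MSequent.inst, List.map_flatMap, List.nodup_flatMap]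
  refine ⟨fun m _ => nodup_snd_inst σ m, (List.pairwise_map.1 hr.nodup).imp_of_mem ?_⟩
  rintro (X | φ) (Y | ψ) hX hY h
  case seq.seq =>
    have hXY : Y ≠ X := fun hYX => h (by rw [hYX])
    simp [Function.onFun, MItem.inst, List.disjoint_left, List.mem_mapIdx, hXY]
  case fml.fml => exact absurd rfl h
  all_goals
    simp [Function.onFun, MItem.inst, MFormula.inst, MFormula.origin, hr.boxed _ ‹_›,
      List.mem_mapIdx]

end Schema

theorem exists_eq_map_of_nodup {α β γ : Type*} [Nonempty γ]
    {L : List (α × β)} {T : List (α × γ)} (hT : T.map Prod.fst = L.map Prod.fst)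
    (hL : (L.map Prod.snd).Nodup) : ∃ ν : β → γ, T = L.map fun x => (x.1, ν x.2) := by
  classical
  inhabit γ
  have hlen : T.length = L.length := by simpa using congrArg List.length hT
  refine ⟨fun o => (T.map Prod.snd).getD ((L.map Prod.snd).idxOf o) default,
    List.ext_getElem (by simpa using hlen) fun i hi _ => Prod.ext ?_ ?_⟩
  · have hfst := List.getElem_of_eq hT (i := i) (by simpa using hi)
    rw [List.getElem_map, List.getElem_map] at hfst
    simpa using hfst
  · have hidx := hL.idxOf_getElem i (by simpa [← hlen] using hi)
    rw [List.getElem_map] at hidx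
    simp [hidx, hi]

/-- The annotated occurrences of an instantiated item: `ν` annotates the instances of sequence
metavariables and `μ` the metaformulas. The annotations choose approximants. -/
def MItem.annotate (σ : Instantiation) (ν : Origin → ℕ) (μ : Formula → ℕ) :
    MItem → List ((Formula × Origin) × ℕ)
  | .seq X => (σ.seq X).mapIdx fun i φ => ((φ, .seqVar X i), ν (.seqVar X i))
  | .fml φ => [(φ.inst σ, μ φ.fml)]

/-- The annotated left-hand side of an instantiated sequent. -/
def MSequent.annotate (σ : Instantiation) (ν : Origin → ℕ) (μ : Formula → ℕ) (S : MSequent) :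
    List ((Formula × Origin) × ℕ) :=
  S.ant.flatMap (MItem.annotate σ ν μ)

theorem map_mapIdx {α β γ : Type*} (f : β → γ) (g : ℕ → α → β) (l : List α) :
    (l.mapIdx g).map f = l.mapIdx fun i x => f (g i x) := by
  apply List.ext_getElem?
  simp [Function.comp_def]

theorem MSequent.map_fst_annotate (σ : Instantiation) (ν : Origin → ℕ) (μ : Formula → ℕ)
    (S : MSequent) : (S.annotate σ ν μ).map Prod.fst = (S.inst σ).ant := by
  rw [annotate, inst, List.map_flatMap]
  congr 1
  funext m
  cases m <;> simp [MItem.annotate, MItem.inst, map_mapIdx]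

theorem MSequent.mem_annotate {σ : Instantiation} {ν : Origin → ℕ} {μ : Formula → ℕ}
    {S : MSequent} {φ : Formula} {o : Origin} {n : ℕ} (h : ((φ, o), n) ∈ S.annotate σ ν μ) :
    ((∃ X i, o = .seqVar X i) ∧ n = ν o) ∨
      ∃ ψ, MItem.fml ψ ∈ S.ant ∧ φ = ψ.fml.subst σ.fml ∧ o = ψ.origin ∧ n = μ ψ.fml := by
  obtain ⟨X | ψ, hm, h⟩ := List.mem_flatMap.1 h
  · simp only [MItem.annotate, List.mem_mapIdx, Prod.mk.injEq] at h
    obtain ⟨i, _, ⟨_, rfl⟩, rfl⟩ := h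
    exact .inl ⟨⟨X, i, rfl⟩, rfl⟩
  · simp only [MItem.annotate, MFormula.inst, List.mem_singleton, Prod.mk.injEq] at h
    exact .inr ⟨ψ, hm, h.1.1, h.1.2, h.2⟩

theorem MFormula.origin_eq_box {φ : MFormula} (h : φ.boxed = true) : φ.origin = .box :=
  if_pos h

theorem MFormula.origin_ne_seqVar (φ : MFormula) (X i : ℕ) : φ.origin ≠ .seqVar X i := by
  rw [origin]
  split
  · simp
  · split <;> simp

theorem Schema.IsLinear.annotate_eq_map {r : Schema} (hr : r.IsLinear) (σ : Instantiation)
    (ν : Origin → ℕ) :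
    r.concl.annotate σ ν (fun _ => ν .box) = (r.concl.inst σ).ant.map fun x => (x, ν x.2) := by
  rw [← MSequent.map_fst_annotate σ ν fun _ => ν .box, List.map_map]
  refine ((List.map_congr_left fun x hx => ?_).trans (List.map_id _)).symm
  obtain ⟨⟨φ, o⟩, n⟩ := x
  rcases MSequent.mem_annotate hx with ⟨-, rfl⟩ | ⟨ψ, hψ, -, rfl, rfl⟩
  · rfl
  · simp [MFormula.origin_eq_box (hr.boxed ψ hψ)]

section Value

variable {A : Type u} [ActionLattice A] {v : ℕ → A} {f : Formula → ℕ → A}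

/-- The values of the sequence metavariables that an instantiation and an annotation determine. -/
def Instantiation.value (σ : Instantiation) (ν : Origin → ℕ) (f : Formula → ℕ → A) (X : ℕ) : A :=
  ((σ.seq X).mapIdx fun i φ => f φ (ν (.seqVar X i))).prod

theorem MSequent.holdsWith_iff_prod_annotate_le {σ : Instantiation} {ν : Origin → ℕ}
    {μ : Formula → ℕ} {S : MSequent} :
    S.HoldsWith v f σ.fml (σ.value ν f) μ ↔
      ((S.annotate σ ν μ).map fun x => f x.1.1 x.2).prod ≤ (S.inst σ).succ.1.eval v := by
  have map_eq : (MItem.value f σ.fml (σ.value ν f) μ) =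
      fun m => ((m.annotate σ ν μ).map fun x => f x.1.1 x.2).prod := by
    funext m
    cases m <;> simp [MItem.annotate, MItem.value, Instantiation.value, map_mapIdx, MFormula.inst]
  rw [HoldsWith, annotate, List.map_flatMap, List.flatMap_def, List.prod_flatten, List.map_map,
    map_eq]
  rfl

/-- The list `T` annotates the left-hand side of the sequent, and the inequation with the
corresponding approximants fails. -/
structure Sequent.FailsWith (v : ℕ → A) (f : Formula → ℕ → A) (S : Sequent)
    (T : List (Formula × ℕ)) : Prop where
  map_fst : T.map Prod.fst = S.ant
  not_le : ¬ (T.map fun x => f x.1 x.2).prod ≤ S.succ.eval v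

/-- The annotations of stars do not increase from the conclusion `C` to the premise `P`, and
decrease if the star is principal. -/
def AnnotationDecreases (C P : TracedSequent) (T T' : List (Formula × ℕ)) : Prop :=
  ∀ i j α a b, T[i]? = some (.star α, a) → T'[j]? = some (.star α, b) →
    ImmediateAncestor C P (some i) (some j) →
      b ≤ a ∧ (∀ φ, C.formulaAt (some i) = some (φ, .box) → b < a)

/-- Soundness of a rule instance, read upwards: if the conclusion fails, then some premise fails
with a decreased annotation. -/
def RuleInstance.ReflectsFailure (v : ℕ → A) (f : Formula → ℕ → A) (s : RuleInstance) : Prop :=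
  ∀ T, s.concl.toSequent.FailsWith v f T → ∃ i P T', s.prem i = some P ∧
    P.toSequent.FailsWith v f T' ∧ AnnotationDecreases s.concl P T T'

theorem Schema.IsLinear.annotationDecreases_annotate {r : Schema} (hr : r.IsLinear)
    {P : MSequent} {σ : Instantiation} {ν : Origin → ℕ} {μ : Formula → ℕ}
    (hμ : ∀ φ φ' α, MItem.fml φ ∈ r.concl.ant → MItem.fml φ' ∈ P.ant →
      φ.fml.subst σ.fml = .star α → φ'.fml.subst σ.fml = .star α → μ φ'.fml < ν .box) :
    AnnotationDecreases (r.concl.inst σ) (P.inst σ)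
      ((r.concl.inst σ).ant.map fun x => (x.1, ν x.2))
      ((P.annotate σ ν μ).map fun x => (x.1.1, x.2)) := by
  rintro i j α a b ha hb ⟨φ, φ', o, -, hi, hj⟩
  simp only [TracedSequent.formulaAt] at hi hj ⊢
  obtain ⟨rfl, rfl⟩ : φ = .star α ∧ ν o = a := by simpa [hi] using ha
  obtain ⟨rfl, hb⟩ : φ' = .star α ∧ ((φ', o), b) ∈ P.annotate σ ν μ := by
    rw [← MSequent.map_fst_annotate σ ν μ, List.getElem?_map, Option.map_eq_some_iff] at hj
    obtain ⟨⟨x, b'⟩, hx, rfl⟩ := hj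
    obtain ⟨rfl, rfl⟩ : φ' = .star α ∧ b' = b := by simpa [hx] using hb
    exact ⟨rfl, List.mem_of_getElem? hx⟩
  have ha : ((.star α, o), ν o) ∈ r.concl.annotate σ ν fun _ => ν .box :=
    hr.annotate_eq_map σ ν ▸ List.mem_map_of_mem (List.mem_of_getElem? hi)
  rcases MSequent.mem_annotate hb with ⟨⟨X, k, rfl⟩, rfl⟩ | ⟨ψ', hψ', h', rfl, rfl⟩
  · simp [hi]
  rcases MSequent.mem_annotate ha with ⟨⟨X, k, h⟩, -⟩ | ⟨ψ, hψ, h, -, hν⟩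
  · exact absurd h (ψ'.origin_ne_seqVar X k)
  · have hlt := hν ▸ hμ ψ ψ' α hψ hψ' h.symm h'.symm
    exact ⟨hlt.le, fun _ _ => hlt⟩

theorem Schema.LocallySound.reflectsFailure {r : Schema} (hr : r.LocallySound v f)
    (hlin : r.IsLinear) (σ : Instantiation) : (RuleInstance.schema r σ).ReflectsFailure v f := by
  classical
  rintro T ⟨hT, hfail⟩
  obtain ⟨ν, rfl⟩ := exists_eq_map_of_nodup (L := (r.concl.inst σ).ant) hT (hlin.nodup_origin σ)
  have hconcl : ¬ r.concl.HoldsWith v f σ.fml (σ.value ν f) fun _ => ν .box := by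
    rw [MSequent.holdsWith_iff_prod_annotate_le, hlin.annotate_eq_map, List.map_map]
    rwa [List.map_map] at hfail
  obtain ⟨i, P, μ, hP, hPfail, hμ⟩ := hr σ.fml (σ.value ν f) (ν .box) hconcl
  refine ⟨i, P.inst σ, _, by rw [RuleInstance.prem, hP, Option.map_some], ⟨?_, ?_⟩,
    hlin.annotationDecreases_annotate hμ⟩
  · rw [TracedSequent.toSequent, ← MSequent.map_fst_annotate σ ν μ, List.map_map, List.map_map]
    rfl
  · rw [MSequent.holdsWith_iff_prod_annotate_le] at hPfail
    rwa [List.map_map]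

theorem reflectsFailure_ident (hf : IsApproximation v f) (x : ℕ) :
    (RuleInstance.ident x).ReflectsFailure v f := by
  rintro T ⟨hT, hfail⟩
  obtain ⟨⟨φ, n⟩, rfl, rfl⟩ := List.map_eq_singleton_iff.1 hT
  exact absurd (by simp [hf.eq_eval (.var x) n (by simp), RuleInstance.concl,
    TracedSequent.toSequent]) hfail

theorem reflectsFailure_of_mem_rulesWith {starLeft : Schema} {R : Set AnalyticRule}
    (hf : IsApproximation v f) (hlin : starLeft.IsLinear) (hstar : starLeft.LocallySound v f)
    (hR : ∀ q ∈ AnalyticRule.quasiequation '' R, q.Holds A) {s : RuleInstance}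
    (hs : s.rule ∈ rulesWith starLeft R) : s.ReflectsFailure v f := by
  rcases s with x | ⟨r, σ⟩
  · exact reflectsFailure_ident hf x
  obtain (rfl | hr) | ⟨r, hr, rfl⟩ : (r = starLeft ∨ r ∈ Schema.common) ∨
      ∃ r' ∈ R, r'.toSchema = r := by
    simpa [RuleInstance.rule, rulesWith] using hs
  · exact hstar.reflectsFailure hlin σ
  · exact (Schema.locallySound_of_mem_common hf hr).reflectsFailure
      (Schema.isLinear_of_mem_common hr) σ
  · exact (Schema.locallySound_toSchema (hR _ ⟨r, hr, rfl⟩)).reflectsFailure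
      (Schema.isLinear_toSchema r) σ

theorem prod_eval_le_of_forall_annotated (hf : IsApproximation v f) {l : List Formula} {z : A}
    (h : ∀ T : List (Formula × ℕ), T.map Prod.fst = l → (T.map fun x => f x.1 x.2).prod ≤ z) :
    (l.map (Formula.eval v)).prod ≤ z := by
  induction l generalizing z with
  | nil => exact h [] rfl
  | cons φ l ih =>
    rw [List.map_cons, List.prod_cons, mul_le_iff_le_lres]
    refine ih fun T hT => ?_
    rw [← mul_le_iff_le_lres, ← one_mul (_ * _)]
    refine hf.mul_mul_le fun n => ?_
    simpa using h ((φ, n) :: T) (by simp [hT])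

end Value

/-! ### Failing branches -/

section FailingBranch

variable {A : Type u} [ActionLattice A] {v : ℕ → A} {f : Formula → ℕ → A} {rules : Set Rule}
  {π : Preproof rules}

/-- A node of a preproof, together with an annotation with which its sequent fails. -/
structure FailingNode (π : Preproof rules) (v : ℕ → A) (f : Formula → ℕ → A) where
  path : List ℕ
  inst : RuleInstance
  annotated : List (Formula × ℕ)
  node_eq : π.node path = some inst
  fails : inst.concl.toSequent.FailsWith v f annotated

namespace FailingNode

/-- The failing node `y` is a successor of `x`, with a decreased annotation. -/
def Descends (x y : FailingNode π v f) : Prop :=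
  ∃ n P, y.path = x.path ++ [n] ∧ x.inst.prem n = some P ∧
    AnnotationDecreases x.inst.concl P x.annotated y.annotated

theorem exists_descends (h : ∀ s : RuleInstance, s.rule ∈ rules → s.ReflectsFailure v f)
    (x : FailingNode π v f) : ∃ y, x.Descends y := by
  obtain ⟨n, P, T, hP, hT, hdec⟩ := h _ (π.rule_mem _ _ x.node_eq) _ x.fails
  obtain ⟨s, hs, hsP⟩ : ∃ s, π.node (x.path ++ [n]) = some s ∧ s.concl.toSequent = P.toSequent := by
    simpa [hP] using π.premises _ _ x.node_eq n
  exact ⟨⟨_, s, T, hs, hsP ▸ hT⟩, n, P, rfl, hP, hdec⟩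

theorem exists_descending_sequence
    (h : ∀ s : RuleInstance, s.rule ∈ rules → s.ReflectsFailure v f) (x₀ : FailingNode π v f) :
    ∃ x : ℕ → FailingNode π v f, x 0 = x₀ ∧ ∀ i, (x i).Descends (x (i + 1)) := by
  choose next hnext using exists_descends (π := π) h
  refine ⟨fun i => next^[i] x₀, rfl, fun i => ?_⟩
  simp only [Function.iterate_succ_apply']
  exact hnext _

theorem isBranch_path {x : ℕ → FailingNode π v f} (h₀ : (x 0).path = [])
    (hx : ∀ i, (x i).Descends (x (i + 1))) : π.IsBranch fun i => (x i).path :=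
  ⟨h₀, fun i => let ⟨n, _, h, _⟩ := hx i; ⟨n, h⟩, fun i => by simp [(x i).node_eq]⟩

theorem exists_annotated_eq (x : FailingNode π v f) {k : ℕ} {φ : Formula} {o : Origin}
    (h : π.formulaAt x.path (some k) = some (φ, o)) : ∃ a, x.annotated[k]? = some (φ, a) := by
  rw [Preproof.formulaAt, x.node_eq, Option.bind_some, TracedSequent.formulaAt] at h
  have : (x.annotated.map Prod.fst)[k]? = some φ := by
    rw [x.fails.map_fst, TracedSequent.toSequent, List.getElem?_map, h, Option.map_some]
  simpa using this

theorem Descends.annotation_le {x y : FailingNode π v f} (h : x.Descends y) {n k k' a b : ℕ}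
    {α : Formula} (hn : y.path = x.path ++ [n])
    (hanc : π.Ancestor x.path n (some k) (some k'))
    (ha : x.annotated[k]? = some (.star α, a)) (hb : y.annotated[k']? = some (.star α, b)) :
    b ≤ a ∧ (π.Principal x.path (some k) → b < a) := by
  obtain ⟨n', P', hn', hP', hdec⟩ := h
  obtain ⟨s, P, hs, hP, hanc⟩ := hanc
  obtain rfl : x.inst = s := Option.some.inj (x.node_eq.symm.trans hs)
  obtain rfl : n = n' := by simpa using hn.symm.trans hn'
  obtain rfl : P = P' := Option.some.inj (hP.symm.trans hP')
  refine ⟨(hdec k k' α a b ha hb hanc).1, fun ⟨φ, hφ⟩ => (hdec k k' α a b ha hb hanc).2 φ ?_⟩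
  rwa [Preproof.formulaAt, hs, Option.bind_some] at hφ

end FailingNode

theorem finite_setOf_lt_of_forall_le {a : ℕ → ℕ} {i₀ : ℕ} (h : ∀ i ≥ i₀, a (i + 1) ≤ a i) :
    {i | i₀ ≤ i ∧ a (i + 1) < a i}.Finite := by
  have hanti : Antitone fun i => a (i₀ + i) :=
    antitone_nat_of_succ_le fun i => h _ (Nat.le_add_right _ _)
  obtain ⟨n, hn⟩ := WellFoundedLT.antitone_chain_condition hanti
  refine (Set.finite_lt_nat (i₀ + n)).subset fun i ⟨hi, hlt⟩ => ?_
  by_contra! hni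
  have hle : i₀ + n ≤ i := not_lt.1 hni
  have h₁ : a (i₀ + n) = a (i₀ + (i - i₀)) := hn _ (by lia)
  have h₂ : a (i₀ + n) = a (i₀ + (i + 1 - i₀)) := hn _ (by lia)
  rw [Nat.add_sub_cancel' (by lia)] at h₁ h₂
  exact hlt.ne (h₂.symm.trans h₁)

theorem FailingNode.not_isProgressing {x : ℕ → FailingNode π v f}
    (hx : ∀ i, (x i).Descends (x (i + 1))) (I : Set ℕ) (t : ℕ → Occ) :
    ¬ π.IsProgressing (fun i => (x i).path) I t := by
  rintro ⟨-, J, -, -, ⟨⟨⟨i₀, hi₀⟩, hconn, -, hanc⟩, α, hα⟩, hinf⟩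
  have hJ : ∀ i ≥ i₀, i ∈ J := fun i hi =>
    let ⟨j, ⟨hj, _⟩, hij⟩ := hinf.exists_gt i
    hconn.out hi₀ hj ⟨hi, hij.le⟩
  have hann : ∀ i ∈ J, ∃ k a, t i = some k ∧ (x i).annotated[k]? = some (.star α, a) := by
    intro i hi
    obtain ⟨hne, o, ho⟩ := hα i hi
    obtain ⟨k, hk⟩ := Option.ne_none_iff_exists'.1 hne
    obtain ⟨a, ha⟩ := (x i).exists_annotated_eq (hk ▸ ho)
    exact ⟨k, a, hk, ha⟩
  choose! k a htk ha using hann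
  have annotation_le : ∀ i ≥ i₀, a (i + 1) ≤ a i ∧
      (π.Principal (x i).path (t i) → a (i + 1) < a i) := by
    intro i hi
    have hi₁ := hJ (i + 1) (le_add_right hi)
    obtain ⟨n, hn, hanc⟩ := hanc i (hJ i hi) hi₁
    rw [htk _ (hJ i hi), htk _ hi₁] at hanc
    rw [htk _ (hJ i hi)]
    exact (hx i).annotation_le hn hanc (ha i (hJ i hi)) (ha _ hi₁)
  have finite_lt := finite_setOf_lt_of_forall_le fun i hi => (annotation_le i hi).1
  refine hinf (((Set.finite_lt_nat i₀).union finite_lt).subset fun i ⟨_, hprin⟩ => ?_)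
  exact (lt_or_ge i i₀).imp_right fun hi => ⟨hi, (annotation_le i hi).2 hprin⟩

theorem exists_descending_sequence_of_not_holdsAt (hf : IsApproximation v f)
    (h : ∀ s : RuleInstance, s.rule ∈ rules → s.ReflectsFailure v f) {S : Sequent}
    (hS : π.Concludes S) (hfail : ¬ S.toInequation.HoldsAt v) :
    ∃ x : ℕ → FailingNode π v f, (x 0).path = [] ∧ ∀ i, (x i).Descends (x (i + 1)) := by
  obtain ⟨s, hs, rfl⟩ := hS
  rw [Sequent.holdsAt_iff] at hfail
  obtain ⟨T, hT, hTfail⟩ : ∃ T : List (Formula × ℕ), T.map Prod.fst = s.concl.toSequent.ant ∧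
      ¬ (T.map fun x => f x.1 x.2).prod ≤ s.concl.toSequent.succ.eval v := by
    by_contra! hcon
    exact hfail (prod_eval_le_of_forall_annotated hf hcon)
  obtain ⟨x, hx₀, hx⟩ :=
    FailingNode.exists_descending_sequence h ⟨[], s, T, hs, hT, hTfail⟩
  exact ⟨x, by rw [hx₀], hx⟩

end FailingBranch

theorem validIn_of_provable_omegaSystem {R : Set AnalyticRule} {S : Sequent}
    (h : (omegaSystem R).Provable S) : ValidIn.{u} (AnalyticRule.quasiequation '' R) S := by
  obtain ⟨π, hS, hπ⟩ := h
  intro A _ hA hR v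
  by_contra hfail
  have hf := isApproximation_eval v
  obtain ⟨x, hx₀, hx⟩ := exists_descending_sequence_of_not_holdsAt hf
    (fun s => reflectsFailure_of_mem_rulesWith hf Schema.isLinear_starLω
      (Schema.locallySound_starLω hA v) hR) hS hfail
  exact hπ _ (FailingNode.isBranch_path hx₀ hx)

theorem validIn_of_provable_nonWellfoundedSystem {R : Set AnalyticRule} {S : Sequent}
    (h : (nonWellfoundedSystem R).Provable S) :
    ValidIn.{u} (AnalyticRule.quasiequation '' R) S := by
  obtain ⟨π, hS, hπ⟩ := h
  intro A _ hA hR v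
  by_contra hfail
  have hf := isApproximation_approx hA v
  obtain ⟨x, hx₀, hx⟩ := exists_descending_sequence_of_not_holdsAt hf
    (fun s => reflectsFailure_of_mem_rulesWith hf Schema.isLinear_starL
      (Schema.locallySound_starL hA v) hR) hS hfail
  obtain ⟨I, t, ht⟩ := hπ _ (FailingNode.isBranch_path hx₀ hx)
  exact FailingNode.not_isProgressing hx I t ht

/-! ### Subproofs -/

namespace Preproof

variable {rules : Set Rule} {π π' : Preproof rules} {n : ℕ} {p p' : ℕ → List ℕ}

/-- `π'` is the subproof of `π` that ends with the `n`-th premise of the last rule of `π`. -/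
def IsSubproof (π : Preproof rules) (n : ℕ) (π' : Preproof rules) : Prop :=
  ∀ w, π.node (n :: w) = π'.node w

theorem IsBranch.exists_tail (hp : π.IsBranch p) :
    ∃ n p', π.node [n] ≠ none ∧ (∀ i, p (i + 1) = n :: p' i) ∧
      ∀ π', π.IsSubproof n π' → π'.IsBranch p' := by
  obtain ⟨h₀, hsucc, hnode⟩ := hp
  obtain ⟨n, hn⟩ : ∃ n, p 1 = [n] := by simpa [h₀] using hsucc 0
  have exists_cons : ∀ i, ∃ w, p (i + 1) = n :: w := by
    intro i
    induction i with
    | zero => exact ⟨[], hn⟩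
    | succ i ih =>
      obtain ⟨m, hm⟩ := hsucc (i + 1)
      obtain ⟨w, hw⟩ := ih
      exact ⟨w ++ [m], by rw [hm, hw, List.cons_append]⟩
  choose p' hp' using exists_cons
  refine ⟨n, p', hn ▸ hnode 1, hp', fun π' hπ => ⟨?_, fun i => ?_, fun i => ?_⟩⟩
  · simpa [hn] using hp' 0
  · simpa [hp'] using hsucc (i + 1)
  · rw [← hπ, ← hp']
    exact hnode (i + 1)

namespace IsSubproof

theorem formulaAt_cons (h : π.IsSubproof n π') (w : List ℕ) (o : Occ) :
    π.formulaAt (n :: w) o = π'.formulaAt w o := by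
  rw [formulaAt, formulaAt, h]

theorem ancestor_cons_iff (h : π.IsSubproof n π') {w : List ℕ} {k : ℕ} {o o' : Occ} :
    π.Ancestor (n :: w) k o o' ↔ π'.Ancestor w k o o' := by
  rw [Ancestor, Ancestor, h]

theorem principal_cons_iff (h : π.IsSubproof n π') {w : List ℕ} {o : Occ} :
    π.Principal (n :: w) o ↔ π'.Principal w o := by
  rw [Principal, Principal, h.formulaAt_cons]

variable {I : Set ℕ} {t : ℕ → Occ}

theorem isThread_cons (h : π.IsSubproof n π') (hp : ∀ i, p (i + 1) = n :: p' i)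
    (ht : π'.IsThread p' I t) : π.IsThread p (Nat.succ '' I) fun i => t (i - 1) := by
  obtain ⟨hne, hconn, hdef, hanc⟩ := ht
  refine ⟨hne.image _, ⟨?_⟩, ?_, ?_⟩
  · rintro _ ⟨i, hi, rfl⟩ _ ⟨j, hj, rfl⟩ (_ | k) ⟨hik, hkj⟩
    · exact absurd hik (Nat.not_succ_le_zero i)
    · exact ⟨k, hconn.out hi hj ⟨Nat.le_of_succ_le_succ hik, Nat.le_of_succ_le_succ hkj⟩, rfl⟩
  · rintro _ ⟨i, hi, rfl⟩
    rw [Nat.succ_eq_add_one, hp, h.formulaAt_cons]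
    exact hdef i hi
  · rintro _ ⟨i, hi, rfl⟩ ⟨j, hj, hij⟩
    obtain rfl : j = i + 1 := Nat.succ_injective hij
    obtain ⟨m, hm, ha⟩ := hanc i hi hj
    refine ⟨m, by rw [Nat.succ_eq_add_one, hp, hp, hm, List.cons_append], ?_⟩
    rw [Nat.succ_eq_add_one, hp, h.ancestor_cons_iff]
    exact ha

theorem isProgressing_cons (h : π.IsSubproof n π') (hp : ∀ i, p (i + 1) = n :: p' i)
    (ht : π'.IsProgressing p' I t) : π.IsProgressing p (Nat.succ '' I) fun i => t (i - 1) := by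
  obtain ⟨ht, J, hJ, hfinal, ⟨hthread, α, hα⟩, hinf⟩ := ht
  refine ⟨h.isThread_cons hp ht, Nat.succ '' J, Set.image_mono hJ, ?_,
    ⟨h.isThread_cons hp hthread, α, ?_⟩, (hinf.image Nat.succ_injective.injOn).mono ?_⟩
  · rintro _ ⟨i, hi, rfl⟩ _ ⟨j, hj, rfl⟩ hij
    exact ⟨j, hfinal i hi j hj (Nat.le_of_succ_le_succ hij), rfl⟩
  · rintro _ ⟨i, hi, rfl⟩
    rw [Nat.succ_eq_add_one, hp, h.formulaAt_cons]
    exact hα i hi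
  · rintro _ ⟨i, ⟨hi, hprin⟩, rfl⟩
    refine ⟨⟨i, hi, rfl⟩, ?_⟩
    rw [Nat.succ_eq_add_one, hp, h.principal_cons_iff]
    exact hprin

end IsSubproof

end Preproof

/-- A branch satisfies the branch condition as soon as the rest of it does so in an immediate
subproof. -/
def ProofSystem.IsTailClosed (L : ProofSystem) : Prop :=
  ∀ (π π' : Preproof L.rules) (n : ℕ) (p p' : ℕ → List ℕ), π.IsSubproof n π' →
    (∀ i, p (i + 1) = n :: p' i) → L.branchCondition π' p' → L.branchCondition π p

theorem isTailClosed_omegaSystem (R : Set AnalyticRule) : (omegaSystem R).IsTailClosed :=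
  fun _ _ _ _ _ _ _ h => h

theorem isTailClosed_nonWellfoundedSystem (R : Set AnalyticRule) :
    (nonWellfoundedSystem R).IsTailClosed :=
  fun _ _ _ _ _ h hp ⟨_, _, ht⟩ => ⟨_, _, h.isProgressing_cons hp ht⟩

/-! ### Preproofs defined by corecursion -/

/-- A system of equations for preproofs, indexed by `Q`: the preproof for `q` ends with `label q`,
and the subproof for each premise is again given by the system, or is a preproof that has been
built before. -/
structure ProofEquations (rules : Set Rule) (Q : Type*) where
  label : Q → RuleInstance
  child : Q → ℕ → Option (Q ⊕ Preproof rules)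
  rule_mem : ∀ q, (label q).rule ∈ rules
  premises : ∀ q i, ((child q i).bind (Sum.elim (some ∘ label) fun π => π.node [])).map
    (fun s => s.concl.toSequent) = ((label q).prem i).map TracedSequent.toSequent

namespace ProofEquations

variable {rules : Set Rule} {Q : Type*} (e : ProofEquations rules Q)

/-- The nodes of the solution. -/
def node : Q → List ℕ → Option RuleInstance
  | q, [] => some (e.label q)
  | q, i :: w => (e.child q i).bind (Sum.elim (fun q' => node q' w) fun π => π.node w)

theorem node_cons_inl {q q' : Q} {i : ℕ} (h : e.child q i = some (.inl q')) (w : List ℕ) :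
    e.node q (i :: w) = e.node q' w := by
  simp [node, h]

theorem node_cons_inr {q : Q} {i : ℕ} {π : Preproof rules} (h : e.child q i = some (.inr π))
    (w : List ℕ) : e.node q (i :: w) = π.node w := by
  simp [node, h]

theorem node_cons_none {q : Q} {i : ℕ} (h : e.child q i = none) (w : List ℕ) :
    e.node q (i :: w) = none := by
  simp [node, h]

theorem prefix_closed (q : Q) (w : List ℕ) (i : ℕ) (h : e.node q (w ++ [i]) ≠ none) :
    e.node q w ≠ none := by
  induction w generalizing q with
  | nil => simp [node]
  | cons j w ih =>
    rw [List.cons_append] at h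
    match hc : e.child q j with
    | none => exact absurd (e.node_cons_none hc _) h
    | some (.inl q') =>
      rw [e.node_cons_inl hc] at h ⊢
      exact ih q' h
    | some (.inr π) =>
      rw [e.node_cons_inr hc] at h ⊢
      exact π.prefix_closed w i h

theorem rule_mem_of_node_eq (q : Q) (w : List ℕ) (s : RuleInstance) (h : e.node q w = some s) :
    s.rule ∈ rules := by
  induction w generalizing q with
  | nil =>
    obtain rfl : e.label q = s := Option.some.inj h
    exact e.rule_mem q
  | cons j w ih =>
    match hc : e.child q j with
    | none => simp [e.node_cons_none hc] at h
    | some (.inl q') => exact ih q' (e.node_cons_inl hc w ▸ h)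
    | some (.inr π) => exact π.rule_mem w s (e.node_cons_inr hc w ▸ h)

theorem premises_node (q : Q) (w : List ℕ) (s : RuleInstance) (h : e.node q w = some s) (i : ℕ) :
    (e.node q (w ++ [i])).map (fun s' => s'.concl.toSequent) =
      (s.prem i).map TracedSequent.toSequent := by
  induction w generalizing q with
  | nil =>
    obtain rfl : e.label q = s := Option.some.inj h
    rw [← e.premises q i]
    simp only [List.nil_append, node]
    rfl
  | cons j w ih =>
    rw [List.cons_append]
    match hc : e.child q j with
    | none => simp [e.node_cons_none hc] at h
    | some (.inl q') =>
      rw [e.node_cons_inl hc] at h ⊢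
      exact ih q' h
    | some (.inr π) =>
      rw [e.node_cons_inr hc] at h ⊢
      exact π.premises w s h i

/-- The preproof that a system of equations defines for `q`. -/
def solution (q : Q) : Preproof rules where
  node := e.node q
  root_mem := Option.some_ne_none _
  prefix_closed := e.prefix_closed q
  rule_mem := e.rule_mem_of_node_eq q
  premises := e.premises_node q

theorem concludes_solution (q : Q) : (e.solution q).Concludes (e.label q).concl.toSequent :=
  ⟨_, rfl, rfl⟩

theorem isSubproof_inl {q q' : Q} {n : ℕ} (h : e.child q n = some (.inl q')) :
    (e.solution q).IsSubproof n (e.solution q') :=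
  e.node_cons_inl h

theorem isSubproof_inr {q : Q} {n : ℕ} {π : Preproof rules} (h : e.child q n = some (.inr π)) :
    (e.solution q).IsSubproof n π :=
  e.node_cons_inr h

end ProofEquations

namespace ProofSystem

variable {L : ProofSystem}

theorem IsTailClosed.provable_of_premises (hL : L.IsTailClosed) {s : RuleInstance}
    (hs : s.rule ∈ L.rules) (h : ∀ i P, s.prem i = some P → L.Provable P.toSequent) :
    L.Provable s.concl.toSequent := by
  have exists_subproof : ∀ i, ∃ c : Option (Preproof L.rules),
      ((c.bind fun π => π.node []).map fun s' => s'.concl.toSequent) =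
        (s.prem i).map TracedSequent.toSequent ∧
      ∀ π ∈ c, ∀ p, π.IsBranch p → L.branchCondition π p := by
    intro i
    match hP : s.prem i with
    | none => exact ⟨none, rfl, by simp⟩
    | some P =>
      obtain ⟨π, ⟨s', hs', hconcl⟩, hπ⟩ := h i P hP
      exact ⟨some π, by simp [hs', hconcl], by simpa using hπ⟩
  choose c hc hbranch using exists_subproof
  let e : ProofEquations L.rules Unit :=
    { label _ := s
      child _ i := (c i).map .inr
      rule_mem _ := hs
      premises _ i := by rw [← hc i, Option.bind_map]; rfl }
  refine ⟨e.solution (), e.concludes_solution (), fun p hp => ?_⟩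
  obtain ⟨n, p', hn, hp', htail⟩ := hp.exists_tail
  match hcn : c n with
  | none => exact absurd (e.node_cons_none (q := ()) (by simp [e, hcn]) []) hn
  | some π =>
    have hsub := e.isSubproof_inr (q := ()) (n := n) (π := π) (by simp [e, hcn])
    exact hL _ _ n p p' hsub hp' (hbranch n π hcn p' (htail π hsub))

end ProofSystem

/-! ### Instances of rules -/

/-- The instantiation of the metavariables of the principal rules. -/
def instantiate (Γ Δ E : List Formula) (α α₀ α₁ β : Formula) : Instantiation where
  seq | 0 => Γ | 1 => Δ | _ => E
  fml | 0 => α | 1 => α₀ | 2 => α₁ | _ => β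

/-- The formulas of an instantiated item. -/
def MItem.formulas (σ : Instantiation) : MItem → List Formula
  | .seq X => σ.seq X
  | .fml φ => [φ.fml.subst σ.fml]

theorem MSequent.toSequent_inst (σ : Instantiation) (S : MSequent) :
    (S.inst σ).toSequent = ⟨S.ant.flatMap (MItem.formulas σ), S.succ.fml.subst σ.fml⟩ := by
  rw [TracedSequent.toSequent, MSequent.inst, List.map_flatMap]
  congr 1
  refine List.flatMap_congr fun m _ => ?_
  cases m
  · rw [MItem.inst, map_mapIdx]
    exact List.ext_getElem? (by simp [MItem.formulas])
  · simp [MItem.inst, MFormula.inst, MItem.formulas]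

/-! ### The `ω`-rule in the non-wellfounded system -/

/-- The instance of the unfolding rule whose conclusion is `Γ, α, …, α, α∗, Δ ⇒ β`, with `n` copies
of `α` before the star. -/
def unfolding (Γ Δ : List Formula) (α β : Formula) (n : ℕ) : RuleInstance :=
  .schema .starL (instantiate (Γ ++ List.replicate n α) Δ [] α α α β)

section Unfolding

variable (Γ Δ : List Formula) (α β : Formula)

attribute [local simp] unfolding instantiate RuleInstance.prem RuleInstance.concl Schema.starL
  Schema.ofList Schema.sq Schema.bx Schema.G Schema.D Schema.a Schema.b Formula.subst

theorem toSequent_concl_unfolding (n : ℕ) : (unfolding Γ Δ α β n).concl.toSequent =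
    ⟨Γ ++ List.replicate n α ++ [.star α] ++ Δ, β⟩ := by
  simp [MSequent.toSequent_inst, MItem.formulas]

theorem exists_prem_zero_unfolding (n : ℕ) : ∃ P, (unfolding Γ Δ α β n).prem 0 = some P ∧
    P.toSequent = ⟨Γ ++ List.replicate n α ++ Δ, β⟩ :=
  ⟨_, rfl, by simp [MSequent.toSequent_inst, MItem.formulas]⟩

theorem exists_prem_one_unfolding (n : ℕ) : ∃ P, (unfolding Γ Δ α β n).prem 1 = some P ∧
    P.toSequent = (unfolding Γ Δ α β (n + 1)).concl.toSequent ∧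
    P.formulaAt (some (Γ.length + (n + 1))) = some (.star α, .box) := by
  refine ⟨_, rfl, ?_, ?_⟩
  · simp [MSequent.toSequent_inst, MItem.formulas, List.replicate_succ']
  · simp [MSequent.inst, MItem.inst, MFormula.inst, MFormula.origin, TracedSequent.formulaAt,
      ← add_assoc]

theorem formulaAt_concl_unfolding (n : ℕ) :
    (unfolding Γ Δ α β n).concl.formulaAt (some (Γ.length + n)) = some (.star α, .box) := by
  simp [MSequent.inst, MItem.inst, MFormula.inst, MFormula.origin, TracedSequent.formulaAt]

end Unfolding

section Comb

variable {R : Set AnalyticRule} {Γ Δ : List Formula} {α β : Formula}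
  (π : ℕ → Preproof (nonWellfoundedSystem R).rules)
  (hπ : ∀ n, (π n).Concludes ⟨Γ ++ List.replicate n α ++ Δ, β⟩)

/-- The equations for the preproof of `Γ, α∗, Δ ⇒ β` that unfolds the star again and again, and
closes the `n`-th side branch by the given preproof of `Γ, α, …, α, Δ ⇒ β`. -/
def combEquations : ProofEquations (nonWellfoundedSystem R).rules ℕ where
  label := unfolding Γ Δ α β
  child n
    | 0 => some (.inr (π n))
    | 1 => some (.inl (n + 1))
    | _ + 2 => none
  rule_mem n := .inr ⟨.starL, .inl (.inr rfl), rfl⟩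
  premises n
    | 0 => by
      obtain ⟨P, hP, hseq⟩ := exists_prem_zero_unfolding Γ Δ α β n
      obtain ⟨s, hs, hconcl⟩ := hπ n
      simp [hP, hseq, hs, hconcl]
    | 1 => by
      obtain ⟨P, hP, hseq, -⟩ := exists_prem_one_unfolding Γ Δ α β n
      simp [hP, hseq]
    | _ + 2 => rfl

theorem node_combEquations_replicate (n i : ℕ) :
    ((combEquations π hπ).solution n).node (List.replicate i 1) =
      some (unfolding Γ Δ α β (n + i)) := by
  induction i generalizing n with
  | zero => rfl
  | succ i ih =>
    have hsub : ((combEquations π hπ).solution n).IsSubproof 1 _ :=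
      (combEquations π hπ).isSubproof_inl (q' := n + 1) rfl
    rw [List.replicate_succ, hsub, ih, Nat.add_right_comm, Nat.add_assoc]

theorem isProgressing_comb {p : ℕ → List ℕ} (hp : ∀ i, p i = List.replicate i 1) :
    ((combEquations π hπ).solution 0).IsProgressing p Set.univ fun i => some (Γ.length + i) := by
  have hnode : ∀ i, ((combEquations π hπ).solution 0).node (p i) = some (unfolding Γ Δ α β i) := by
    intro i
    rw [hp, node_combEquations_replicate, Nat.zero_add]
  have hfml : ∀ i, ((combEquations π hπ).solution 0).formulaAt (p i) (some (Γ.length + i)) =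
      some (.star α, .box) := by
    intro i
    rw [Preproof.formulaAt, hnode, Option.bind_some, formulaAt_concl_unfolding]
  have hthread : ((combEquations π hπ).solution 0).IsThread p Set.univ
      fun i => some (Γ.length + i) := by
    refine ⟨Set.univ_nonempty, Set.ordConnected_univ, fun i _ => by simp [hfml], fun i _ _ => ?_⟩
    obtain ⟨P, hP, -, hstar⟩ := exists_prem_one_unfolding Γ Δ α β i
    exact ⟨1, by rw [hp, hp, List.replicate_succ'], _, P, hnode i, hP, .star α, .star α, .box,
      by simp, formulaAt_concl_unfolding Γ Δ α β i, hstar⟩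
  refine ⟨hthread, Set.univ, subset_rfl, fun _ _ _ _ _ => trivial,
    ⟨hthread, α, fun i _ => ⟨by simp, _, hfml i⟩⟩, ?_⟩
  exact Set.infinite_univ.mono fun i _ => ⟨trivial, _, hfml i⟩

theorem branch_comb_eq_replicate
    (hcond : ∀ n p, (π n).IsBranch p → (nonWellfoundedSystem R).branchCondition (π n) p)
    {n : ℕ} {p : ℕ → List ℕ} (hp : ((combEquations π hπ).solution n).IsBranch p)
    (hnot : ¬ (nonWellfoundedSystem R).branchCondition ((combEquations π hπ).solution n) p)
    (i : ℕ) : p i = List.replicate i 1 := by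
  induction i generalizing n p with
  | zero => exact hp.1
  | succ i ih =>
    obtain ⟨k, p', hk, hp', htail⟩ := hp.exists_tail
    have not_tail : ∀ π', ((combEquations π hπ).solution n).IsSubproof k π' →
        ¬ (nonWellfoundedSystem R).branchCondition π' p' := fun π' hsub h =>
      hnot (isTailClosed_nonWellfoundedSystem R _ π' k p p' hsub hp' h)
    match k with
    | 0 =>
      have hsub := (combEquations π hπ).isSubproof_inr (q := n) (n := 0) rfl
      exact absurd (hcond n p' (htail _ hsub)) (not_tail _ hsub)
    | 1 =>
      have hsub := (combEquations π hπ).isSubproof_inl (q := n) (n := 1) rfl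
      rw [hp', ih (htail _ hsub) (not_tail _ hsub), List.replicate_succ]
    | k + 2 => exact absurd rfl hk

end Comb

theorem provable_star_of_forall_provable {R : Set AnalyticRule} {Γ Δ : List Formula}
    {α β : Formula}
    (h : ∀ n, (nonWellfoundedSystem R).Provable ⟨Γ ++ List.replicate n α ++ Δ, β⟩) :
    (nonWellfoundedSystem R).Provable ⟨Γ ++ [.star α] ++ Δ, β⟩ := by
  choose π hπ hcond using h
  refine ⟨(combEquations π hπ).solution 0, ?_, fun p hp => ?_⟩
  · simpa [combEquations, toSequent_concl_unfolding] using (combEquations π hπ).concludes_solution 0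
  · by_contra hnot
    exact hnot ⟨_, _, isProgressing_comb π hπ (branch_comb_eq_replicate π hπ hcond hp hnot)⟩

/-! ### Sets of sequents that are closed under rules -/

section StarLω

attribute [local simp] Schema.starLω Schema.sq Schema.bx Schema.G Schema.D Schema.a Schema.b
  Formula.subst MItem.formulas

theorem toSequent_concl_starLω (σ : Instantiation) :
    (RuleInstance.schema .starLω σ).concl.toSequent =
      ⟨σ.seq 0 ++ [.star (σ.fml 0)] ++ σ.seq 1, σ.fml 3⟩ := by
  simp [RuleInstance.concl, MSequent.toSequent_inst]

theorem toSequent_prem_starLω {σ : Instantiation} {n : ℕ} {Q : TracedSequent}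
    (hQ : (RuleInstance.schema .starLω σ).prem n = some Q) :
    Q.toSequent = ⟨σ.seq 0 ++ List.replicate n (σ.fml 0) ++ σ.seq 1, σ.fml 3⟩ := by
  obtain rfl := Option.some.inj hQ
  simp [MSequent.toSequent_inst, List.flatMap_replicate]

end StarLω

/-- The instantiation of the metavariables of an analytic rule. -/
def AnalyticRule.instantiate (r : AnalyticRule) (Γ Δ : List Formula) (β : Formula)
    (x : ℕ → List Formula) : Instantiation where
  seq := Function.update (Function.update x r.Γ Γ) r.Δ Δ
  fml _ := β

theorem AnalyticRule.toSequent_sequent_inst (r : AnalyticRule) {Γ Δ : List Formula} {β : Formula}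
    (x : ℕ → List Formula) {l : List ℕ} (hl : ∀ X ∈ l, X ∈ r.Υ) :
    ((r.sequent l).inst (r.instantiate Γ Δ β x)).toSequent = ⟨Γ ++ (l.flatMap x ++ Δ), β⟩ := by
  have hnodup := r.nodup
  simp only [List.nodup_cons, List.mem_cons, not_or] at hnodup
  obtain ⟨⟨hΓΔ, hΓ⟩, hΔ, -⟩ := hnodup
  have hx : l.flatMap (r.instantiate Γ Δ β x).seq = l.flatMap x := by
    refine List.flatMap_congr fun X hX => ?_
    exact (Function.update_of_ne (ne_of_mem_of_not_mem (hl X hX) hΔ) _ _).trans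
      (Function.update_of_ne (ne_of_mem_of_not_mem (hl X hX) hΓ) _ _)
  simp only [MSequent.toSequent_inst, AnalyticRule.sequent, List.flatMap_cons, List.flatMap_append,
    List.flatMap_map, List.flatMap_nil, MItem.formulas, hx, Formula.subst, List.append_nil]
  simp [AnalyticRule.instantiate, hΓΔ]

/-- A set of sequents is closed under a set of rules if it contains the conclusion of each instance
of the rules whose premises it contains. -/
def IsClosedUnder (rules : Set Rule) (P : Sequent → Prop) : Prop :=
  ∀ s : RuleInstance, s.rule ∈ rules → (∀ i Q, s.prem i = some Q → P Q.toSequent) →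
    P s.concl.toSequent

namespace IsClosedUnder

theorem ofList {rules : Set Rule} {P : Sequent → Prop} (hP : IsClosedUnder rules P)
    {prems : List MSequent} {concl : MSequent} (hr : .schema (.ofList prems concl) ∈ rules)
    (σ : Instantiation) (h : ∀ p ∈ prems, P (p.inst σ).toSequent) :
    P (concl.inst σ).toSequent := by
  refine hP (.schema (.ofList prems concl) σ) hr fun i Q hQ => ?_
  obtain ⟨p, hp, rfl⟩ := Option.map_eq_some_iff.1 hQ
  exact h p (List.mem_of_getElem? hp)

variable {R : Set AnalyticRule} {P : Sequent → Prop}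
  (hP : IsClosedUnder (rulesWith Schema.starLω R) P) {Γ Δ E : List Formula} {α α₀ α₁ β : Formula}
include hP

theorem common {prems : List MSequent} {concl : MSequent}
    (hr : Schema.ofList prems concl ∈ Schema.common) (σ : Instantiation)
    (h : ∀ p ∈ prems, P ⟨p.ant.flatMap (MItem.formulas σ), p.succ.fml.subst σ.fml⟩) :
    P ⟨concl.ant.flatMap (MItem.formulas σ), concl.succ.fml.subst σ.fml⟩ := by
  simp only [← MSequent.toSequent_inst] at h ⊢
  exact hP.ofList (.inr ⟨_, .inl (.inl hr), rfl⟩) σ h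

theorem ident (x : ℕ) : P ⟨[.var x], .var x⟩ :=
  hP (.ident x) (.inl rfl) fun _ _ h => nomatch h

attribute [local simp] Schema.sq Schema.sqb Schema.bx Schema.G Schema.D Schema.E Schema.a Schema.a₀
  Schema.a₁ Schema.b Formula.subst instantiate MItem.formulas

theorem zeroL : P ⟨Γ ++ .zero :: Δ, β⟩ := by
  simpa using hP.common (show Schema.zeroL ∈ _ by simp [Schema.common])
    (instantiate Γ Δ [] β β β β)

theorem oneL (h : P ⟨Γ ++ Δ, β⟩) : P ⟨Γ ++ .one :: Δ, β⟩ := by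
  simpa [h] using hP.common (show Schema.oneL ∈ _ by simp [Schema.common])
    (instantiate Γ Δ [] β β β β)

theorem oneR : P ⟨[], .one⟩ := by
  simpa using hP.common (show Schema.oneR ∈ _ by simp [Schema.common])
    (instantiate [] [] [] .one .one .one .one)

theorem infL₀ (h : P ⟨Γ ++ α₀ :: Δ, β⟩) : P ⟨Γ ++ .inf α₀ α₁ :: Δ, β⟩ := by
  simpa [h] using hP.common (show Schema.infL₀ ∈ _ by simp [Schema.common])
    (instantiate Γ Δ [] α₀ α₀ α₁ β)

theorem infL₁ (h : P ⟨Γ ++ α₁ :: Δ, β⟩) : P ⟨Γ ++ .inf α₀ α₁ :: Δ, β⟩ := by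
  simpa [h] using hP.common (show Schema.infL₁ ∈ _ by simp [Schema.common])
    (instantiate Γ Δ [] α₀ α₀ α₁ β)

theorem infR (h₀ : P ⟨Γ, α₀⟩) (h₁ : P ⟨Γ, α₁⟩) : P ⟨Γ, .inf α₀ α₁⟩ := by
  simpa [h₀, h₁] using hP.common (show Schema.infR ∈ _ by simp [Schema.common])
    (instantiate Γ [] [] α₀ α₀ α₁ α₀)

theorem supL (h₀ : P ⟨Γ ++ α₀ :: Δ, β⟩) (h₁ : P ⟨Γ ++ α₁ :: Δ, β⟩) :
    P ⟨Γ ++ .sup α₀ α₁ :: Δ, β⟩ := by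
  simpa [h₀, h₁] using hP.common (show Schema.supL ∈ _ by simp [Schema.common])
    (instantiate Γ Δ [] α₀ α₀ α₁ β)

theorem supR₀ (h : P ⟨Γ, α₀⟩) : P ⟨Γ, .sup α₀ α₁⟩ := by
  simpa [h] using hP.common (show Schema.supR₀ ∈ _ by simp [Schema.common])
    (instantiate Γ [] [] α₀ α₀ α₁ α₀)

theorem supR₁ (h : P ⟨Γ, α₁⟩) : P ⟨Γ, .sup α₀ α₁⟩ := by
  simpa [h] using hP.common (show Schema.supR₁ ∈ _ by simp [Schema.common])
    (instantiate Γ [] [] α₀ α₀ α₁ α₀)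

theorem mulL (h : P ⟨Γ ++ α₀ :: α₁ :: Δ, β⟩) : P ⟨Γ ++ .mul α₀ α₁ :: Δ, β⟩ := by
  simpa [h] using hP.common (show Schema.mulL ∈ _ by simp [Schema.common])
    (instantiate Γ Δ [] α₀ α₀ α₁ β)

theorem mulR (h₀ : P ⟨Γ, α₀⟩) (h₁ : P ⟨Δ, α₁⟩) : P ⟨Γ ++ Δ, .mul α₀ α₁⟩ := by
  simpa [h₀, h₁] using hP.common (show Schema.mulR ∈ _ by simp [Schema.common])
    (instantiate Γ Δ [] α₀ α₀ α₁ α₀)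

theorem lresL (h₀ : P ⟨Δ, α₀⟩) (h₁ : P ⟨Γ ++ α₁ :: E, β⟩) :
    P ⟨Γ ++ (Δ ++ .lres α₀ α₁ :: E), β⟩ := by
  simpa [h₀, h₁] using hP.common (show Schema.lresL ∈ _ by simp [Schema.common])
    (instantiate Γ Δ E α₀ α₀ α₁ β)

theorem rresL (h₀ : P ⟨Δ, α₀⟩) (h₁ : P ⟨Γ ++ α₁ :: E, β⟩) :
    P ⟨Γ ++ .rres α₁ α₀ :: (Δ ++ E), β⟩ := by
  simpa [h₀, h₁] using hP.common (show Schema.rresL ∈ _ by simp [Schema.common])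
    (instantiate Γ Δ E α₀ α₀ α₁ β)

theorem lresR (h : P ⟨α₀ :: Γ, α₁⟩) : P ⟨Γ, .lres α₀ α₁⟩ := by
  simpa [h] using hP.common (show Schema.lresR ∈ _ by simp [Schema.common])
    (instantiate Γ [] [] α₀ α₀ α₁ α₀)

theorem rresR (h : P ⟨Γ ++ [α₀], α₁⟩) : P ⟨Γ, .rres α₁ α₀⟩ := by
  simpa [h] using hP.common (show Schema.rresR ∈ _ by simp [Schema.common])
    (instantiate Γ [] [] α₀ α₀ α₁ α₀)

theorem starR₀ : P ⟨[], .star α⟩ := by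
  simpa using hP.common (show Schema.starR₀ ∈ _ by simp [Schema.common])
    (instantiate [] [] [] α α α α)

theorem starR₁ (h₀ : P ⟨Γ, α⟩) (h₁ : P ⟨Δ, .star α⟩) : P ⟨Γ ++ Δ, .star α⟩ := by
  simpa [h₀, h₁] using hP.common (show Schema.starR₁ ∈ _ by simp [Schema.common])
    (instantiate Γ Δ [] α α α α)

theorem starL (h : ∀ n, P ⟨Γ ++ (List.replicate n α ++ Δ), β⟩) : P ⟨Γ ++ .star α :: Δ, β⟩ := by
  have hconcl := hP (.schema .starLω (instantiate Γ Δ [] α α α β))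
    (.inr ⟨_, .inl (.inr rfl), rfl⟩) fun n Q hQ => by
      rw [toSequent_prem_starLω hQ]
      simpa using h n
  simpa [toSequent_concl_starLω] using hconcl

theorem analytic {r : AnalyticRule} (hr : r ∈ R) (x : ℕ → List Formula)
    (h : ∀ l ∈ r.prems, P ⟨Γ ++ (l.flatMap x ++ Δ), β⟩) :
    P ⟨Γ ++ (r.Υ.flatMap x ++ Δ), β⟩ := by
  rw [← r.toSequent_sequent_inst x fun _ => id]
  refine hP.ofList (.inr ⟨_, .inr ⟨r, hr, rfl⟩, rfl⟩) _ (List.forall_mem_map.2 fun l hl => ?_)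
  rw [r.toSequent_sequent_inst x (r.prems_sub l hl)]
  exact h l hl

end IsClosedUnder

theorem isClosedUnder_provable_omegaSystem (R : Set AnalyticRule) :
    IsClosedUnder (rulesWith Schema.starLω R) (omegaSystem R).Provable :=
  fun _ hs h => (isTailClosed_omegaSystem R).provable_of_premises hs h

theorem isClosedUnder_provable_nonWellfoundedSystem (R : Set AnalyticRule) :
    IsClosedUnder (rulesWith Schema.starLω R) (nonWellfoundedSystem R).Provable := by
  intro s hs h
  have provable_of_mem (hs' : s.rule ∈ (nonWellfoundedSystem R).rules) :
      (nonWellfoundedSystem R).Provable s.concl.toSequent :=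
    (isTailClosed_nonWellfoundedSystem R).provable_of_premises hs' h
  match s with
  | .ident x => exact provable_of_mem (.inl rfl)
  | .schema r σ =>
    obtain hr | ⟨_, (hr | rfl) | hr, ⟨⟩⟩ := hs
    · cases hr
    · exact provable_of_mem (.inr ⟨r, .inl (.inl hr), rfl⟩)
    · rw [toSequent_concl_starLω]
      exact provable_star_of_forall_provable fun n => toSequent_prem_starLω (σ := σ) rfl ▸ h n _ rfl
    · exact provable_of_mem (.inr ⟨r, .inr hr, rfl⟩)

/-! ### The quantale of closed sets -/

section ClosedSet

open scoped Pointwise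

universe v w

variable {M : Type v} [Monoid M] {ι : Type*} {B : ι → Set M}

/-- The members of `M` that belong to a set `B i` in each context in which all the members of `S`
belong to it. -/
def contextClosure (B : ι → Set M) (S : Set M) : Set M :=
  {x | ∀ i a b, (∀ y ∈ S, a * y * b ∈ B i) → a * x * b ∈ B i}

/-- The subsets of `M` that are closed under `contextClosure B`. They form a quantale, and hence a
`*`-continuous action lattice, in which `M` is represented. The universe `w` is arbitrary, so that
this algebra exists in each universe in which validity may be tested. -/
@[ext]
structure ClosedSet (B : ι → Set M) : Type (max v w) where
  carrier : Set M
  contextClosure_subset : contextClosure B carrier ⊆ carrier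

namespace ClosedSet

instance : SetLike (ClosedSet.{v, w} B) M where
  coe := carrier
  coe_injective _ _ := ClosedSet.ext

instance : PartialOrder (ClosedSet.{v, w} B) := .ofSetLike _ M

/-- The least closed set that contains `S`. -/
def generate (S : Set M) : ClosedSet.{v, w} B where
  carrier := contextClosure B S
  contextClosure_subset _ h i a b hS := h i a b fun _ hy => hy i a b hS

theorem subset_generate (S : Set M) : S ⊆ (generate S : ClosedSet.{v, w} B) :=
  fun x hx _ _ _ h => h x hx

theorem mem_of_forall (X : ClosedSet.{v, w} B) {x : M}
    (h : ∀ i a b, (∀ y ∈ X, a * y * b ∈ B i) → a * x * b ∈ B i) : x ∈ X :=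
  X.contextClosure_subset h

theorem generate_le_iff {S : Set M} {X : ClosedSet.{v, w} B} : generate S ≤ X ↔ S ⊆ X :=
  ⟨(subset_generate S).trans, fun h _ hx => X.mem_of_forall fun i a b hX =>
    hx i a b fun y hy => hX y (h hy)⟩

/-- The closed sets are the fixed points of a closure operator, whence they form a complete
lattice. -/
def generateInsertion : GaloisInsertion (generate (B := B)) ((↑) : ClosedSet.{v, w} B → Set M) where
  choice S _ := generate S
  gc _ _ := generate_le_iff
  le_l_u X := subset_generate (X : Set M)
  choice_eq _ _ := rfl

instance : CompleteLattice (ClosedSet.{v, w} B) := generateInsertion.liftCompleteLattice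

/-- The set `B i` as a closed set. -/
def base (i : ι) : ClosedSet.{v, w} B where
  carrier := B i
  contextClosure_subset x h := by simpa using h i 1 1

theorem mem_inf_iff {X Y : ClosedSet.{v, w} B} {x : M} : x ∈ X ⊓ Y ↔ x ∈ X ∧ x ∈ Y :=
  Set.ext_iff.1 generateInsertion.gc.u_inf x

instance : One (ClosedSet.{v, w} B) := ⟨generate 1⟩

instance : Mul (ClosedSet.{v, w} B) := ⟨fun X Y => generate ((X : Set M) * Y)⟩

theorem one_le_iff {X : ClosedSet.{v, w} B} : 1 ≤ X ↔ 1 ∈ X :=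
  generate_le_iff.trans Set.one_subset

theorem mul_le_iff {X Y Z : ClosedSet.{v, w} B} :
    X * Y ≤ Z ↔ ∀ x ∈ X, ∀ y ∈ Y, x * y ∈ Z :=
  generate_le_iff.trans Set.mul_subset_iff

theorem generate_mul_generate (S T : Set M) :
    (generate S * generate T : ClosedSet.{v, w} B) = generate (S * T) := by
  refine le_antisymm (mul_le_iff.2 fun x hx y hy => ?_)
    (generate_le_iff.2 <| (Set.mul_subset_mul (subset_generate S) (subset_generate T)).trans <|
      subset_generate _)
  intro i a b h
  have mem_of_mem_left : ∀ s ∈ S, a * s * y * b ∈ B i := fun s hs =>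
    mul_assoc (a * s) y b ▸ hy i (a * s) b fun t ht => by
      simpa [mul_assoc] using h _ (Set.mul_mem_mul hs ht)
  simpa [mul_assoc] using hx i a (y * b) fun s hs => by simpa [mul_assoc] using mem_of_mem_left s hs

theorem generate_mul_generate_le_iff {S T : Set M} {X : ClosedSet.{v, w} B} :
    generate S * generate T ≤ X ↔ ∀ x ∈ S, ∀ y ∈ T, x * y ∈ X := by
  rw [generate_mul_generate, generate_le_iff, Set.mul_subset_iff]
  rfl

theorem generate_surjective : Function.Surjective (generate : Set M → ClosedSet.{v, w} B) :=
  generateInsertion.l_surjective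

theorem generate_coe (X : ClosedSet.{v, w} B) : generate (X : Set M) = X :=
  generateInsertion.l_u_eq X

instance : Monoid (ClosedSet.{v, w} B) where
  __ := generate_surjective.semigroup _ fun _ _ => (generate_mul_generate _ _).symm
  __ := generate_surjective.mulOneClass _ rfl fun _ _ => (generate_mul_generate _ _).symm

instance : IsQuantale (ClosedSet.{v, w} B) where
  mul_sSup_distrib X s := eq_of_forall_ge_iff fun Z => by
    rw [← generate_coe X, ← generateInsertion.l_sSup_u_image, generate_mul_generate_le_iff]
    simp only [Set.sSup_eq_sUnion, Set.mem_sUnion, Set.mem_image, exists_exists_and_eq_and,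
      SetLike.mem_coe, iSup_le_iff, generate_coe, mul_le_iff]
    exact ⟨fun h Y hY x hx y hy => h x hx y ⟨Y, hY, hy⟩,
      fun h x hx y ⟨Y, hY, hy⟩ => h Y hY x hx y hy⟩
  sSup_mul_distrib s Y := eq_of_forall_ge_iff fun Z => by
    rw [← generate_coe Y, ← generateInsertion.l_sSup_u_image, generate_mul_generate_le_iff]
    simp only [Set.sSup_eq_sUnion, Set.mem_sUnion, Set.mem_image, exists_exists_and_eq_and,
      SetLike.mem_coe, iSup_le_iff, generate_coe, mul_le_iff]
    exact ⟨fun h X hX x hx y hy => h x ⟨X, hX, hx⟩ y hy,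
      fun h x ⟨X, hX, hx⟩ y hy => h X hX x hx y hy⟩

instance : ActionLattice (ClosedSet.{v, w} B) := actionLatticeOfQuantale _

theorem mem_lres_iff {X Z : ClosedSet.{v, w} B} {y : M} :
    y ∈ ResiduatedLattice.lres X Z ↔ ∀ x ∈ X, x * y ∈ Z := by
  rw [← SetLike.mem_coe, ← Set.singleton_subset_iff, ← generate_le_iff, ← mul_le_iff_le_lres]
  nth_rw 1 [← generate_coe X]
  rw [generate_mul_generate_le_iff]
  simp

theorem mem_rres_iff {Y Z : ClosedSet.{v, w} B} {x : M} :
    x ∈ ResiduatedLattice.rres Z Y ↔ ∀ y ∈ Y, x * y ∈ Z := by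
  rw [← SetLike.mem_coe, ← Set.singleton_subset_iff, ← generate_le_iff, ← mul_le_iff_le_rres]
  nth_rw 1 [← generate_coe Y]
  rw [generate_mul_generate_le_iff]
  simp

theorem star_le_iff {X Y : ClosedSet.{v, w} B} : X∗ ≤ Y ↔ ∀ n : ℕ, X ^ n ≤ Y :=
  iSup_le_iff

theorem mul_mem_mul {X Y : ClosedSet.{v, w} B} {x y : M} (hx : x ∈ X) (hy : y ∈ Y) :
    x * y ∈ X * Y :=
  mul_le_iff.1 le_rfl x hx y hy

theorem one_mem_one : (1 : M) ∈ (1 : ClosedSet.{v, w} B) :=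
  one_le_iff.1 le_rfl

theorem pow_mem_pow {X : ClosedSet.{v, w} B} {x : M} (hx : x ∈ X) (n : ℕ) : x ^ n ∈ X ^ n := by
  induction n with
  | zero => simpa only [pow_zero] using one_mem_one
  | succ n ih => simpa only [pow_succ] using mul_mem_mul ih hx

theorem prod_map_mem_prod_map {α : Type*} {f : α → ClosedSet.{v, w} B} {g : α → M} {l : List α}
    (h : ∀ a ∈ l, g a ∈ f a) : (l.map g).prod ∈ (l.map f).prod := by
  induction l with
  | nil => exact one_mem_one
  | cons a l ih =>
    rw [List.forall_mem_cons] at h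
    simpa only [List.map_cons, List.prod_cons] using mul_mem_mul h.1 (ih h.2)

theorem prod_map_le_iff {α : Type*} {f : α → ClosedSet.{v, w} B} {l : List α} (hl : l.Nodup)
    {X : ClosedSet.{v, w} B} :
    (l.map f).prod ≤ X ↔ ∀ g : α → M, (∀ a ∈ l, g a ∈ f a) → (l.map g).prod ∈ X := by
  classical
  refine ⟨fun h g hg => h (prod_map_mem_prod_map hg), fun h => ?_⟩
  induction l generalizing X with
  | nil => exact one_le_iff.2 (h 1 (by simp))
  | cons a l ih =>
    rw [List.nodup_cons] at hl
    rw [List.map_cons, List.prod_cons, mul_le_iff_le_lres]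
    refine ih hl.2 fun g hg => mem_lres_iff.2 fun x hx => ?_
    have update_eq : ∀ b ∈ l, Function.update g a x b = g b := fun b hb =>
      Function.update_of_ne (ne_of_mem_of_not_mem hb hl.1) _ _
    have hprod := h (Function.update g a x) <| List.forall_mem_cons.2
      ⟨by rwa [Function.update_self], fun b hb => update_eq b hb ▸ hg b hb⟩
    rwa [List.map_cons, List.prod_cons, Function.update_self,
      List.map_congr_left update_eq] at hprod

end ClosedSet

end ClosedSet

/-! ### The canonical algebra of a set of sequents -/

/-- The action lattice of those sets of sequences of formulas that are closed with respect to
derivability in contexts, where derivability means membership in `P`. -/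
abbrev CanonicalAlgebra (P : Sequent → Prop) : Type u :=
  ClosedSet.{0, u} fun β => {Γ : FreeMonoid Formula | P ⟨Γ.toList, β⟩}

namespace CanonicalAlgebra

variable {P : Sequent → Prop} {R : Set AnalyticRule} {X Y : CanonicalAlgebra.{u} P} {φ ψ : Formula}

theorem mem_of_forall_context {Φ : FreeMonoid Formula}
    (h : ∀ Γ Δ β, (∀ E ∈ X, P ⟨Γ ++ (E.toList ++ Δ), β⟩) → P ⟨Γ ++ (Φ.toList ++ Δ), β⟩) :
    Φ ∈ X := by
  refine X.mem_of_forall fun β Γ Δ hX => ?_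
  simp only [mul_assoc] at hX ⊢
  exact h Γ.toList Δ.toList β hX

theorem holds_quasiequation (hP : IsClosedUnder (rulesWith Schema.starLω R) P) {r : AnalyticRule}
    (hr : r ∈ R) : r.quasiequation.Holds (CanonicalAlgebra.{u} P) := by
  intro v
  simp only [AnalyticRule.quasiequation, AnalyticRule.term, Inequation.HoldsAt, Formula.eval_prod,
    List.forall_mem_map, List.map_map, Formula.eval, Function.comp_def]
  intro h
  rw [ClosedSet.prod_map_le_iff r.nodup.of_cons.of_cons]
  refine fun x hx => mem_of_forall_context fun Γ Δ β hβ => ?_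
  simp only [FreeMonoid.toList_prod, List.map_map, ← List.flatMap_def] at hβ ⊢
  refine hP.analytic hr (fun X => (x X).toList) fun l hl => ?_
  simpa [FreeMonoid.toList_prod, List.flatMap_def, Function.comp_def] using hβ _ (h l hl <|
    ClosedSet.prod_map_mem_prod_map fun X hX => hx X (r.prems_sub l hl X hX))

/-- The element `X` of the canonical algebra represents the formula `φ`: it contains `φ`, and all
its members derive `φ`. -/
def Represents (X : CanonicalAlgebra.{u} P) (φ : Formula) : Prop :=
  FreeMonoid.of φ ∈ X ∧ ∀ Γ ∈ X, P ⟨Γ.toList, φ⟩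

/-- The valuation that sends each variable to the closed set that the variable generates. -/
def canonicalValuation (P : Sequent → Prop) (x : ℕ) : CanonicalAlgebra.{u} P :=
  ClosedSet.generate {FreeMonoid.of (.var x)}

theorem le_base_iff : X ≤ ClosedSet.base φ ↔ ∀ Γ ∈ X, P ⟨Γ.toList, φ⟩ :=
  Iff.rfl

theorem toList_of_pow (φ : Formula) (n : ℕ) :
    (FreeMonoid.of φ ^ n).toList = List.replicate n φ := by
  induction n with
  | zero => rfl
  | succ n ih => rw [pow_succ', FreeMonoid.toList_of_mul, ih, List.replicate_succ]

section Represents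

variable (hP : IsClosedUnder (rulesWith Schema.starLω R) P)
include hP

theorem represents_canonicalValuation (x : ℕ) :
    Represents (canonicalValuation.{u} P x) (.var x) :=
  ⟨ClosedSet.subset_generate _ rfl,
    le_base_iff.1 <| ClosedSet.generate_le_iff.2 <| Set.singleton_subset_iff.2 <| hP.ident x⟩

theorem represents_bot : Represents (⊥ : CanonicalAlgebra.{u} P) .zero :=
  ⟨mem_of_forall_context fun _ _ _ _ => hP.zeroL, le_base_iff.1 bot_le⟩

theorem represents_one : Represents (1 : CanonicalAlgebra.{u} P) .one :=
  ⟨mem_of_forall_context fun _ _ _ h => hP.oneL (h 1 ClosedSet.one_mem_one),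
    le_base_iff.1 <| ClosedSet.one_le_iff.2 hP.oneR⟩

theorem Represents.inf (hX : Represents X φ) (hY : Represents Y ψ) :
    Represents (X ⊓ Y) (.inf φ ψ) := by
  refine ⟨ClosedSet.mem_inf_iff.2 ⟨?_, ?_⟩, fun Γ hΓ => ?_⟩
  · exact mem_of_forall_context fun _ _ _ h => hP.infL₀ (h _ hX.1)
  · exact mem_of_forall_context fun _ _ _ h => hP.infL₁ (h _ hY.1)
  · rw [ClosedSet.mem_inf_iff] at hΓ
    exact hP.infR (hX.2 Γ hΓ.1) (hY.2 Γ hΓ.2)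

theorem Represents.sup (hX : Represents X φ) (hY : Represents Y ψ) :
    Represents (X ⊔ Y) (.sup φ ψ) :=
  ⟨mem_of_forall_context fun _ _ _ h =>
      hP.supL (h _ (le_sup_left (b := Y) hX.1)) (h _ (le_sup_right (a := X) hY.1)),
    le_base_iff.1 <| sup_le (fun Γ hΓ => hP.supR₀ (hX.2 Γ hΓ)) fun Γ hΓ => hP.supR₁ (hY.2 Γ hΓ)⟩

theorem Represents.mul (hX : Represents X φ) (hY : Represents Y ψ) :
    Represents (X * Y) (.mul φ ψ) :=
  ⟨mem_of_forall_context fun _ _ _ h => hP.mulL (h _ (ClosedSet.mul_mem_mul hX.1 hY.1)),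
    le_base_iff.1 <| ClosedSet.mul_le_iff.2 fun Γ hΓ Δ hΔ => hP.mulR (hX.2 Γ hΓ) (hY.2 Δ hΔ)⟩

theorem Represents.lres (hX : Represents X φ) (hY : Represents Y ψ) :
    Represents (ResiduatedLattice.lres X Y) (.lres φ ψ) := by
  refine ⟨ClosedSet.mem_lres_iff.2 fun Γ hΓ => mem_of_forall_context fun Δ E β h => ?_,
    fun Γ hΓ => hP.lresR (hY.2 _ (ClosedSet.mem_lres_iff.1 hΓ _ hX.1))⟩
  simpa using hP.lresL (hX.2 Γ hΓ) (h _ hY.1)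

theorem Represents.rres (hX : Represents X φ) (hY : Represents Y ψ) :
    Represents (ResiduatedLattice.rres X Y) (.rres φ ψ) := by
  refine ⟨ClosedSet.mem_rres_iff.2 fun Γ hΓ => mem_of_forall_context fun Δ E β h => ?_,
    fun Γ hΓ => hP.rresR (hX.2 _ (ClosedSet.mem_rres_iff.1 hΓ _ hY.1))⟩
  simpa using hP.rresL (hY.2 Γ hΓ) (h _ hX.1)

theorem pow_le_base_star (h : ∀ Γ ∈ X, P ⟨Γ.toList, φ⟩) (n : ℕ) :
    X ^ n ≤ ClosedSet.base (.star φ) := by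
  induction n with
  | zero => rw [pow_zero]; exact ClosedSet.one_le_iff.2 hP.starR₀
  | succ n ih =>
    rw [pow_succ']
    exact ClosedSet.mul_le_iff.2 fun Γ hΓ Δ hΔ => hP.starR₁ (h Γ hΓ) (le_base_iff.1 ih Δ hΔ)

theorem Represents.star (hX : Represents X φ) : Represents X∗ (.star φ) := by
  refine ⟨mem_of_forall_context fun Γ Δ β h => hP.starL fun n => ?_,
    le_base_iff.1 <| ClosedSet.star_le_iff.2 <| pow_le_base_star hP hX.2⟩
  rw [← toList_of_pow]
  exact h _ (ClosedSet.star_le_iff.1 le_rfl n (ClosedSet.pow_mem_pow hX.1 n))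

theorem represents_eval (φ : Formula) :
    Represents (φ.eval (canonicalValuation.{u} P)) φ := by
  induction φ with
  | var x => exact represents_canonicalValuation hP x
  | zero => exact represents_bot hP
  | one => exact represents_one hP
  | inf _ _ ihφ ihψ => exact ihφ.inf hP ihψ
  | sup _ _ ihφ ihψ => exact ihφ.sup hP ihψ
  | mul _ _ ihφ ihψ => exact ihφ.mul hP ihψ
  | lres _ _ ihφ ihψ => exact ihφ.lres hP ihψ
  | rres _ _ ihφ ihψ => exact ihφ.rres hP ihψ
  | star _ ih => exact ih.star hP

end Represents

end CanonicalAlgebra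

theorem IsClosedUnder.of_validIn {R : Set AnalyticRule} {P : Sequent → Prop}
    (hP : IsClosedUnder (rulesWith Schema.starLω R) P) {S : Sequent}
    (hS : ValidIn.{u} (AnalyticRule.quasiequation '' R) S) : P S := by
  have hle := (S.holdsAt_iff _).1 <| hS (CanonicalAlgebra.{u} P)
    isStarContinuous_actionLatticeOfQuantale
    (Set.forall_mem_image.2 fun _ => CanonicalAlgebra.holds_quasiequation hP)
    (CanonicalAlgebra.canonicalValuation P)
  have hant := ClosedSet.prod_map_mem_prod_map (g := FreeMonoid.of) fun φ (_ : φ ∈ S.ant) =>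
    (CanonicalAlgebra.represents_eval.{u} hP φ).1
  simpa [FreeMonoid.toList_prod, ← List.flatMap_def, Function.comp_def] using
    (CanonicalAlgebra.represents_eval hP S.succ).2 _ (hle hant)

end ActionLogic

theorem mainTheorem1 (R : Set ActionLogic.AnalyticRule) :
    (∀ S : ActionLogic.Sequent,
      (ActionLogic.omegaSystem R).Provable S ↔
        ActionLogic.ValidIn.{u} (ActionLogic.AnalyticRule.quasiequation '' R) S) ∧
    (∀ S : ActionLogic.Sequent,
      (ActionLogic.nonWellfoundedSystem R).Provable S ↔
        ActionLogic.ValidIn.{u} (ActionLogic.AnalyticRule.quasiequation '' R) S) :=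
  ⟨fun _ => ⟨ActionLogic.validIn_of_provable_omegaSystem,
      (ActionLogic.isClosedUnder_provable_omegaSystem R).of_validIn⟩,
    fun _ => ⟨ActionLogic.validIn_of_provable_nonWellfoundedSystem,
      (ActionLogic.isClosedUnder_provable_nonWellfoundedSystem R).of_validIn⟩⟩
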